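/- Let $q$ be an odd prime power and let $\mathbb{F}_q$ be the field with $q$ elements. A conic of $\mathrm{PG}(2,q)$ is a nonzero quadratic form $f=\sum_{0\le i\le j\le 2}a_{ij}X_iX_j$ over $\mathbb{F}_q$, taken up to nonzero scalars. It is a double line if $f=c\,\ell^2$ with $c\in\mathbb{F}_q$ and $\ell$ a linear form over $\mathbb{F}_q$; a real line pair if $f=\ell m$ with $\ell,m$ non-proportional linear forms over $\mathbb{F}_q$; an imaginary line pair if $f=c\,\ell\,\bar\ell$ with $\ell$ a linear form over $\mathbb{F}_{q^2}$ not proportional to its conjugate $\bar\ell$ under $x\mapsto x^q$; and non-singular if $4a_{00}a_{11}a_{22}+a_{01}a_{02}a_{12}-a_{00}a_{12}^2-a_{11}a_{02}^2-a_{22}a_{01}^2\neq 0$. To the conic $f$ corresponds the hyperplane $a_{00}Y_0+a_{01}Y_1+a_{02}Y_2+a_{11}Y_3+a_{12}Y_4+a_{22}Y_5=0$ of $\mathrm{PG}(5,q)$; let $\mathcal{H}_1,\mathcal{H}_{2,r},\mathcal{H}_{2,i},\mathcal{H}_3$ be the sets of hyperplanes corresponding to double lines, real line pairs, imaginary line pairs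 and non-singular conics, respectively. Represent a point $P=(y_0,\dots,y_5)$ of $\mathrm{PG}(5,q)$ by the symmetric matrix $$M_P=\begin{bmatrix}y_0&y_1&y_2\\ y_1&y_3&y_4\\ y_2&y_4&y_5\end{bmatrix},$$ and let the rank of $P$ be the rank of $M_P$. Let $K\cong\mathrm{PGL}(3,q)$ be the group acting on $\mathrm{PG}(5,q)$ by $M\mapsto AMA^{T}$, $A\in\mathrm{GL}(3,q)$. Let $\nu(u_0,u_1,u_2)=(u_0^2,u_0u_1,u_0u_2,u_1^2,u_1u_2,u_2^2)$ be the Veronese map from $\mathrm{PG}(2,q)$ to $\mathrm{PG}(5,q)$. The image under $\nu$ of a line of $\mathrm{PG}(2,q)$ is a conic $\mathcal{C}$ in the plane it spans, and a tangent line of $\mathcal{C}$ is a line of that plane meeting $\mathcal{C}$ in exactly one point. A point $P$ of rank $2$ is exterior if it lies in the plane of such a conic $\mathcal{C}$ and on a tangent line of $\mathcal{C}$, and interior otherwise. Let $\mathcal{P}_1,\mathcal{P}_{2,e},\mathcal{P}_{2,i},\mathcal{P}_3$ be the sets of points of rank $1$, exterior points of rank $2$, interior points of rank $2$, and points of rank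 $3$, respectively. Then $\mathcal{P}_1,\mathcal{P}_{2,e},\mathcal{P}_{2,i},\mathcal{P}_3$ are precisely the $K$-orbits of points of $\mathrm{PG}(5,q)$, and $\mathcal{H}_1,\mathcal{H}_{2,r},\mathcal{H}_{2,i},\mathcal{H}_3$ are precisely the $K$-orbits of hyperplanes of $\mathrm{PG}(5,q)$ (four distinct orbits in each case). The hyperplane-orbit distribution $OD_4(P)=[h_1,h_{2,r},h_{2,i},h_3]$, which lists the numbers of hyperplanes through $P$ belonging to $\mathcal{H}_1,\mathcal{H}_{2,r},\mathcal{H}_{2,i},\mathcal{H}_3$ respectively, is $$OD_4(P)=\begin{cases} \left[q+1,\ q^3+\frac{3q^2+q}{2},\ \frac{q^2-q}{2},\ q^4-q^2\right] & \text{if } P\in\mathcal{P}_1,\\[4pt] \left[2q+1,\ \frac{q^3+3q^2}{2},\ \frac{q^3+q^2}{2}-q,\ q^4-q^2\right] & \text{if } P\in\mathcal{P}_{2,e},\\[4pt] \left[1,\ \frac{q^3+3q^2}{2}+q,\ \frac{q^3+q^2}{2},\ q^4-q^2\right] & \text{if } P\in\mathcal{P}_{2,i},\\[4pt] \left[q+1,\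 \frac{q^3+2q^2+q}{2},\ \frac{q^3-q}{2},\ q^4\right] & \text{if } P\in\mathcal{P}_3. \end{cases}$$ Moreover, for every squab $\mathcal{S}$ of conics in $\mathrm{PG}(2,q)$ (that is, a linear system given by a $5$-dimensional subspace of the $6$-dimensional space of ternary quadratic forms) there is a unique point $P_{\mathcal{S}}$ of $\mathrm{PG}(5,q)$ such that the conics in $\mathcal{S}$ are exactly those whose corresponding hyperplanes contain $P_{\mathcal{S}}$, and the numbers of double lines, real line pairs, imaginary line pairs and non-singular conics in $\mathcal{S}$ are, in this order, the entries of $OD_4(P_{\mathcal{S}})$. -/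

import Mathlib

open scoped Matrix

noncomputable section

namespace VeroneseConics

/-- The plane `PG(2,q)` over the field `F`. -/
abbrev PG2 (F : Type*) [Field F] := Projectivization F (Fin 3 → F)

/-- The space `PG(5,q)` over the field `F`, with coordinates `(y₀, …, y₅)`. -/
abbrev PG5 (F : Type*) [Field F] := Projectivization F (Fin 6 → F)

/-- The six-dimensional space of ternary quadratic forms over `F`. -/
abbrev QForms (F : Type*) [Field F] := MvPolynomial.homogeneousSubmodule (Fin 3) F 2

/-- Conics of `PG(2,q)`: nonzero ternary quadratic forms up to a nonzero scalar. -/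
abbrev Conic (F : Type*) [Field F] := Projectivization F (QForms F)

/-! ### The Veronese surface -/

/-- The symmetric matrix attached to the coordinate vector of a point of `PG(5,q)`. -/
def symMat {F : Type*} (y : Fin 6 → F) : Matrix (Fin 3) (Fin 3) F :=
  !![y 0, y 1, y 2; y 1, y 3, y 4; y 2, y 4, y 5]

/-- The entries on and above the diagonal, listed row by row (inverse of `symMat` on symmetric
matrices). -/
def upperEntries {F : Type*} (M : Matrix (Fin 3) (Fin 3) F) : Fin 6 → F :=
  ![M 0 0, M 0 1, M 0 2, M 1 1, M 1 2, M 2 2]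

/-- The Veronese map on coordinate vectors. -/
def veroneseVec {F : Type*} [Field F] (u : Fin 3 → F) : Fin 6 → F :=
  ![u 0 ^ 2, u 0 * u 1, u 0 * u 2, u 1 ^ 2, u 1 * u 2, u 2 ^ 2]

theorem veroneseVec_ne_zero {F : Type*} [Field F] {u : Fin 3 → F} (hu : u ≠ 0) :
    veroneseVec u ≠ 0 := by
  intro h
  apply hu
  have h0 := congrFun h 0
  have h3 := congrFun h 3
  have h5 := congrFun h 5
  simp [veroneseVec] at h0 h3 h5
  funext i
  fin_cases i <;> simp [h0, h3, h5]

/-- The Veronese map `PG(2,q) → PG(5,q)`. -/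
def veronese {F : Type*} [Field F] (u : PG2 F) : PG5 F :=
  Projectivization.mk F (veroneseVec u.rep) (veroneseVec_ne_zero u.rep_nonzero)

/-- The rank of a point of `PG(5,q)`. -/
def pointRank {F : Type*} [Field F] (P : PG5 F) : ℕ := (symMat P.rep).rank

/-- The conic of the Veronese surface that is the image of the line `l` of `PG(2,q)`
(lines are two-dimensional subspaces of `F³`). -/
def veroneseConic {F : Type*} [Field F] (l : Submodule F (Fin 3 → F)) : Set (PG5 F) :=
  veronese '' {u | u.submodule ≤ l}

/-- The subspace spanned by a set of points of `PG(5,q)`. -/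
def pointSpan {F : Type*} [Field F] (C : Set (PG5 F)) : Submodule F (Fin 6 → F) :=
  ⨆ R ∈ C, R.submodule

/-- `T` is a tangent line of the conic `C` of the Veronese surface: a line in the plane of `C`
that meets `C` in exactly one point. -/
def IsTangentLine {F : Type*} [Field F] (C : Set (PG5 F)) (T : Submodule F (Fin 6 → F)) : Prop :=
  Module.finrank F T = 2 ∧ T ≤ pointSpan C ∧ ∃! R : PG5 F, R ∈ C ∧ R.submodule ≤ T

/-- `P` lies in the plane of some conic of the Veronese surface and on a tangent line of
that conic. -/
def OnTangentLine {F : Type*} [Field F] (P : PG5 F) : Prop :=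
  ∃ l : Submodule F (Fin 3 → F), Module.finrank F l = 2 ∧
    P.submodule ≤ pointSpan (veroneseConic l) ∧
    ∃ T, IsTangentLine (veroneseConic l) T ∧ P.submodule ≤ T

/-- The points of rank one. -/
def pts1 (F : Type*) [Field F] : Set (PG5 F) := {P | pointRank P = 1}

/-- The exterior points of rank two. -/
def pts2e (F : Type*) [Field F] : Set (PG5 F) := {P | pointRank P = 2 ∧ OnTangentLine P}

/-- The interior points of rank two. -/
def pts2i (F : Type*) [Field F] : Set (PG5 F) := {P | pointRank P = 2 ∧ ¬ OnTangentLine P}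

/-- The points of rank three. -/
def pts3 (F : Type*) [Field F] : Set (PG5 F) := {P | pointRank P = 3}

/-! ### Types of conics -/

/-- The linear form with coefficient vector `v`. -/
def linForm {R : Type*} [CommRing R] (v : Fin 3 → R) : MvPolynomial (Fin 3) R :=
  ∑ i, MvPolynomial.C (v i) * MvPolynomial.X i

/-- The coefficients `(a₀₀, a₀₁, a₀₂, a₁₁, a₁₂, a₂₂)` of a ternary quadratic form, where
`aᵢⱼ` (for `i ≤ j`) is the coefficient of `Xᵢ Xⱼ`. -/
def coeffVec {F : Type*} [Field F] (f : QForms F) : Fin 6 → F :=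
  upperEntries (Matrix.of fun i j =>
    MvPolynomial.coeff (Finsupp.single i 1 + Finsupp.single j 1) (f : MvPolynomial (Fin 3) F))

/-- The discriminant of the quadratic form with coefficient vector `a`. -/
def disc {F : Type*} [Field F] (a : Fin 6 → F) : F :=
  4 * a 0 * a 3 * a 5 + a 1 * a 2 * a 4 - a 0 * a 4 ^ 2 - a 3 * a 2 ^ 2 - a 5 * a 1 ^ 2

/-- Double lines: the form is a scalar multiple of the square of a linear form. -/
def IsDoubleLine {F : Type*} [Field F] (C : Conic F) : Prop :=
  ∃ (a : F) (v : Fin 3 → F),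
    (C.rep : MvPolynomial (Fin 3) F) = MvPolynomial.C a * linForm v ^ 2

/-- Real line pairs: the form is a product of two non-proportional linear forms over `F`. -/
def IsRealLinePair {F : Type*} [Field F] (C : Conic F) : Prop :=
  ∃ v w : Fin 3 → F, LinearIndependent F ![v, w] ∧
    (C.rep : MvPolynomial (Fin 3) F) = linForm v * linForm w

/-- Imaginary line pairs, with respect to the quadratic extension `L` of the finite field `F`:
the form is, up to a scalar, the product of a linear form over `L` and its conjugate under
`x ↦ x ^ |F|`, and these two linear forms are not proportional. -/
def IsImagLinePair {F : Type*} [Field F] (L : Type*) [Field L] [Algebra F L] (C : Conic F) :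
    Prop :=
  ∃ (a : L) (v : Fin 3 → L), LinearIndependent L ![v, fun i => v i ^ Nat.card F] ∧
    MvPolynomial.map (algebraMap F L) (C.rep : MvPolynomial (Fin 3) F) =
      MvPolynomial.C a * linForm v * linForm (fun i => v i ^ Nat.card F)

/-- Non-singular conics. -/
def IsNonsingular {F : Type*} [Field F] (C : Conic F) : Prop := disc (coeffVec C.rep) ≠ 0

/-! ### Hyperplanes -/

/-- The hyperplane `a₀₀ Y₀ + a₀₁ Y₁ + a₀₂ Y₂ + a₁₁ Y₃ + a₁₂ Y₄ + a₂₂ Y₅ = 0` of `PG(5,q)` that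
corresponds to the conic with coefficients `aᵢⱼ`. -/
def conicHyperplane {F : Type*} [Field F] (C : Conic F) : Submodule F (Fin 6 → F) where
  carrier := {y | coeffVec C.rep ⬝ᵥ y = 0}
  add_mem' := by
    intro x y hx hy
    simp only [Set.mem_ofPred_eq] at hx hy ⊢
    rw [dotProduct_add, hx, hy, add_zero]
  zero_mem' := by simp
  smul_mem' := by
    intro c x hx
    simp only [Set.mem_ofPred_eq] at hx ⊢
    rw [dotProduct_smul, hx, smul_zero]

/-- Hyperplanes corresponding to double lines. -/
def hyps1 (F : Type*) [Field F] : Set (Submodule F (Fin 6 → F)) :=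
  conicHyperplane '' {C | IsDoubleLine C}

/-- Hyperplanes corresponding to real line pairs. -/
def hyps2r (F : Type*) [Field F] : Set (Submodule F (Fin 6 → F)) :=
  conicHyperplane '' {C | IsRealLinePair C}

/-- Hyperplanes corresponding to imaginary line pairs. -/
def hyps2i (F : Type*) [Field F] (L : Type*) [Field L] [Algebra F L] :
    Set (Submodule F (Fin 6 → F)) :=
  conicHyperplane '' {C | IsImagLinePair L C}

/-- Hyperplanes corresponding to non-singular conics. -/
def hyps3 (F : Type*) [Field F] : Set (Submodule F (Fin 6 → F)) :=
  conicHyperplane '' {C | IsNonsingular C}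

/-! ### The group action -/

/-- The action of a `3 × 3` matrix `A` on the coordinate vectors of `PG(5,q)`, in terms of
symmetric matrices `M ↦ A M Aᵀ`. -/
def congrMap {F : Type*} [Field F] (A : Matrix (Fin 3) (Fin 3) F) :
    (Fin 6 → F) →ₗ[F] (Fin 6 → F) where
  toFun y := upperEntries (A * symMat y * Aᵀ)
  map_add' x y := by
    have h : symMat (x + y) = symMat x + symMat y := by
      ext i j
      fin_cases i <;> fin_cases j <;> simp [symMat]
    rw [h, Matrix.mul_add, Matrix.add_mul]
    ext i
    fin_cases i <;> simp [upperEntries]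
  map_smul' c x := by
    have h : symMat (c • x) = c • symMat x := by
      ext i j
      fin_cases i <;> fin_cases j <;> simp [symMat]
    rw [h, Matrix.mul_smul, Matrix.smul_mul]
    ext i
    fin_cases i <;> simp [upperEntries]

/-- The orbits on the points of `PG(5,q)` of the group `K`, the lift of `PGL(3,q)` through the
Veronese map. -/
def pointOrbits (F : Type*) [Field F] : Set (Set (PG5 F)) :=
  Set.range fun P : PG5 F =>
    {Q | ∃ A : GL (Fin 3) F, Q.submodule = P.submodule.map (congrMap (A : Matrix _ _ F))}

/-- The orbits on the hyperplanes of `PG(5,q)` of the group `K`, the lift of `PGL(3,q)` through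
the Veronese map. -/
def hyperplaneOrbits (F : Type*) [Field F] : Set (Set (Submodule F (Fin 6 → F))) :=
  (fun H : Submodule F (Fin 6 → F) =>
    {H' | ∃ A : GL (Fin 3) F, H' = H.map (congrMap (A : Matrix _ _ F))}) ''
      {H | Module.finrank F H = 5}

/-! ### Hyperplane-orbit distributions and squabs -/

/-- The hyperplane-orbit distribution `[h₁, h₂ᵣ, h₂ᵢ, h₃]` of a point: the numbers of hyperplanes
of each of the four types through it. -/
def hyperplaneDistribution {F : Type*} [Field F] (L : Type*) [Field L] [Algebra F L] (P : PG5 F) :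
    Fin 4 → ℕ :=
  ![{H | H ∈ hyps1 F ∧ P.submodule ≤ H}.ncard,
    {H | H ∈ hyps2r F ∧ P.submodule ≤ H}.ncard,
    {H | H ∈ hyps2i F L ∧ P.submodule ≤ H}.ncard,
    {H | H ∈ hyps3 F ∧ P.submodule ≤ H}.ncard]

/-- A squab of conics: a linear system of conics of codimension one. -/
def IsSquab {F : Type*} [Field F] (S : Submodule F (QForms F)) : Prop :=
  Module.finrank F S = 5

/-- The point `P` of `PG(5,q)` corresponds to the linear system `S`: the conics in `S` are those
whose hyperplanes contain `P`. -/
def IsPointOf {F : Type*} [Field F] (P : PG5 F) (S : Submodule F (QForms F)) : Prop :=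
  ∀ C : Conic F, C.submodule ≤ S ↔ P.submodule ≤ conicHyperplane C

/-- The numbers of double lines, real line pairs, imaginary line pairs and non-singular conics
in a linear system of conics. -/
def conicDistribution {F : Type*} [Field F] (L : Type*) [Field L] [Algebra F L]
    (S : Submodule F (QForms F)) : Fin 4 → ℕ :=
  ![{C : Conic F | IsDoubleLine C ∧ C.submodule ≤ S}.ncard,
    {C : Conic F | IsRealLinePair C ∧ C.submodule ≤ S}.ncard,
    {C : Conic F | IsImagLinePair L C ∧ C.submodule ≤ S}.ncard,
    {C : Conic F | IsNonsingular C ∧ C.submodule ≤ S}.ncard]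

end VeroneseConics

end

open VeroneseConics

/-! A conic with coefficients `a` and a point with coordinates `y` both give symmetric 3 × 3
matrices, `dualMat a` (twice the Gram matrix) and `symMat y`. Incidence of the point with the
hyperplane of the conic is the trace pairing tr(`dualMat a` * `symMat y`) = 2(a ⬝ y) = 0, so K acts
by congruence on the points and contragrediently on the conics. Both orbit problems thus become the
classification of nonzero symmetric matrices under congruence and scaling (`Sim`).

In odd characteristic such a matrix can be diagonalized. Since every nondegenerate binary form
represents 1, there are four classes: rank one, rank two split, rank two anisotropic, and rank
three. Rank three is a single class because scaling in odd dimension corrects the discriminant. The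
sizes of the kernel and of the set of isotropic vectors separate the classes (`exists_hasType`,
`HasType.unique`). For conics they are the double lines, real line pairs, imaginary line pairs and
non-singular conics. For points the split and anisotropic classes of rank two are the exterior and
interior points, because the tangent line at ν(v) consists of the symmetrized products of v with
vectors of the line.

For the distribution, fix y ≠ 0 and let n_t be the number of vectors a ⊥ y of type t. Four linear
equations hold. The total is known. Double counting the pairs (a, v) with v isotropic for a, and the
triples (a, v, w) with v, w orthogonal for a, gives two more: for fixed v, w the condition on a is
linear, and it is independent of a ⊥ y unless the corresponding square or symmetrized product is a
multiple of `symMat y`. Finally n₀ is one less than the number of isotropic vectors of `symMat y`.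
The right-hand sides depend only on the type of y and the system has a unique solution
(`linear_system_unique`), so it suffices to check that q − 1 times the claimed numbers solve it
(`typeCard_eq`); q − 1 is the number of coefficient vectors of one conic.

A squab is a hyperplane in the space of coefficients, and its point is the normal vector of that
hyperplane. -/

namespace VeroneseConics

variable {F : Type*} [Field F]

/-! ### Congruence of symmetric matrices up to a scalar -/

/-- Congruence of `3 × 3` matrices up to a nonzero scalar. -/
def Sim (M N : Matrix (Fin 3) (Fin 3) F) : Prop :=
  ∃ A : Matrix (Fin 3) (Fin 3) F, ∃ c : F, A.det ≠ 0 ∧ c ≠ 0 ∧ N = c • (A * M * Aᵀ)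

theorem Sim.refl (M : Matrix (Fin 3) (Fin 3) F) : Sim M M :=
  ⟨1, 1, by simp, one_ne_zero, by simp⟩

theorem Sim.symm {M N : Matrix (Fin 3) (Fin 3) F} (h : Sim M N) : Sim N M := by
  obtain ⟨A, c, hA, hc, rfl⟩ := h
  have hu : IsUnit A.det := isUnit_iff_ne_zero.2 hA
  refine ⟨A⁻¹, c⁻¹, ?_, inv_ne_zero hc, ?_⟩
  · rw [Matrix.det_nonsing_inv]
    simpa using hA
  · rw [Matrix.mul_smul, Matrix.smul_mul, smul_smul, inv_mul_cancel₀ hc, one_smul,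
      Matrix.transpose_nonsing_inv, Matrix.mul_assoc,
      Matrix.mul_nonsing_inv_cancel_right _ _ (by rwa [Matrix.det_transpose]),
      Matrix.nonsing_inv_mul_cancel_left _ _ hu]

theorem Sim.trans {M N P : Matrix (Fin 3) (Fin 3) F} (h : Sim M N) (h' : Sim N P) : Sim M P := by
  obtain ⟨A, c, hA, hc, rfl⟩ := h
  obtain ⟨B, d, hB, hd, rfl⟩ := h'
  refine ⟨B * A, d * c, ?_, mul_ne_zero hd hc, ?_⟩
  · rw [Matrix.det_mul]
    exact mul_ne_zero hB hA
  · simp only [Matrix.mul_smul, Matrix.smul_mul, smul_smul, Matrix.transpose_mul, Matrix.mul_assoc]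

theorem Sim.smul (M : Matrix (Fin 3) (Fin 3) F) {c : F} (hc : c ≠ 0) : Sim M (c • M) :=
  ⟨1, c, by simp, hc, by simp⟩

theorem Sim.congr (M : Matrix (Fin 3) (Fin 3) F) {A : Matrix (Fin 3) (Fin 3) F}
    (hA : A.det ≠ 0) : Sim M (A * M * Aᵀ) :=
  ⟨A, 1, hA, one_ne_zero, by simp⟩

theorem Sim.isSymm {M N : Matrix (Fin 3) (Fin 3) F} (h : Sim M N) (hM : M.IsSymm) :
    N.IsSymm := by
  obtain ⟨A, c, hA, hc, rfl⟩ := h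
  simp [Matrix.IsSymm, Matrix.transpose_smul, Matrix.transpose_mul, hM.eq, Matrix.mul_assoc]

theorem Sim.det_ne_zero {M N : Matrix (Fin 3) (Fin 3) F} (h : Sim M N) (hM : M.det ≠ 0) :
    N.det ≠ 0 := by
  obtain ⟨A, c, hA, hc, rfl⟩ := h
  simp [hA, hc, hM]

/-- A symmetric matrix over a field of characteristic not two is congruent to a diagonal one. -/
theorem exists_sim_diagonal (h2 : (2 : F) ≠ 0) {S : Matrix (Fin 3) (Fin 3) F} (hS : S.IsSymm) :
    ∃ d : Fin 3 → F, Sim (Matrix.diagonal d) S := by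
  have : Invertible (2 : F) := invertibleOfNonzero h2
  let B : LinearMap.BilinForm F (Fin 3 → F) := Matrix.toBilin' S
  have hB : LinearMap.IsSymm B := by
    refine ⟨fun x y => ?_⟩
    simp only [B, Matrix.toBilin'_apply', RingHom.id_apply]
    rw [Matrix.dotProduct_mulVec, ← Matrix.mulVec_transpose, hS.eq, dotProduct_comm]
  obtain ⟨v, hv⟩ := LinearMap.BilinForm.exists_orthogonal_basis hB
  let e : Fin (Module.finrank F (Fin 3 → F)) ≃ Fin 3 := finCongr (by simp)
  let b := v.reindex e
  have hb : ∀ i j, i ≠ j → B (b i) (b j) = 0 := by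
    intro i j hij
    simpa [b] using hv (fun h => hij (e.symm.injective h))
  -- The rows of `A` are the orthogonal basis, so `A * S * Aᵀ` is the Gram matrix of that basis and
  -- hence diagonal.
  let A : Matrix (Fin 3) (Fin 3) F := Matrix.of fun i => b i
  have hA : A.det ≠ 0 := by
    have h1 : LinearIndependent F A.row := b.linearIndependent
    rw [Matrix.linearIndependent_rows_iff_isUnit, Matrix.isUnit_iff_isUnit_det] at h1
    exact h1.ne_zero
  refine ⟨fun i => B (b i) (b i), Sim.symm ⟨A, 1, hA, one_ne_zero, ?_⟩⟩
  ext i j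
  have key : (A * S * Aᵀ) i j = B (b i) (b j) := by
    simp only [B, Matrix.toBilin'_apply']
    rw [Matrix.mul_assoc, Matrix.mul_apply_eq_vecMul, Matrix.dotProduct_mulVec]
    simp only [A, Matrix.vecMul, Matrix.mul_apply, dotProduct, Matrix.transpose_apply,
      Matrix.of_apply, Finset.mul_sum, Finset.sum_mul]
    rw [Finset.sum_comm]
    simp only [mul_assoc]
  rw [one_smul, key]
  by_cases hij : i = j
  · subst hij; simp
  · rw [Matrix.diagonal_apply_ne _ hij, hb i j hij]

/-! ### Similarity of diagonal forms -/

theorem sim_diagonal_perm (d : Fin 3 → F) (σ : Equiv.Perm (Fin 3)) :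
    Sim (Matrix.diagonal d) (Matrix.diagonal (d ∘ σ)) := by
  refine ⟨(1 : Matrix (Fin 3) (Fin 3) F).submatrix σ id, 1, ?_, one_ne_zero, ?_⟩
  · rw [Matrix.det_permute]
    rcases Int.units_eq_one_or (Equiv.Perm.sign σ) with h | h <;> simp [h]
  · ext i j
    by_cases h : i = j
    · subst h
      simp [Matrix.mul_apply, Matrix.one_apply, Matrix.diagonal_apply]
    · simp [Matrix.mul_apply, Matrix.one_apply, Matrix.diagonal_apply, h]

theorem sim_diagonal_sq (d t : Fin 3 → F) (ht : ∀ i, t i ≠ 0) :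
    Sim (Matrix.diagonal d) (Matrix.diagonal fun i => t i ^ 2 * d i) := by
  refine ⟨Matrix.diagonal t, 1, ?_, one_ne_zero, ?_⟩
  · rw [Matrix.det_diagonal]
    exact Finset.prod_ne_zero_iff.2 fun i _ => ht i
  · rw [Matrix.diagonal_transpose, Matrix.diagonal_mul_diagonal, Matrix.diagonal_mul_diagonal,
      one_smul]
    congr 1
    funext i
    ring

/-- A nondegenerate binary quadratic form over a finite field of odd order represents one. -/
theorem exists_mul_sq_add_mul_sq_eq_one [Finite F] (h2 : (2 : F) ≠ 0) {a b : F} (ha : a ≠ 0)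
    (hb : b ≠ 0) : ∃ x y : F, a * x ^ 2 + b * y ^ 2 = 1 := by
  have := Fintype.ofFinite F
  have hodd : Fintype.card F % 2 = 1 := by
    rcases Nat.mod_two_eq_zero_or_one (Fintype.card F) with h | h
    · rw [← FiniteField.even_card_iff_char_two] at h
      exact absurd (by exact_mod_cast h ▸ ringChar.Nat.cast_ringChar (R := F)) h2
    · exact h
  -- Pigeonhole: the sets of values of aX² and of 1 − bX² each contain more than half of the field,
  -- so they meet.
  open Polynomial in
  obtain ⟨x, y, h⟩ := FiniteField.exists_root_sum_quadratic (R := F)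
    (f := C a * X ^ 2 + C 0 * X + C 0) (g := C b * X ^ 2 + C 0 * X + C (-1))
    (degree_quadratic ha) (degree_quadratic hb) hodd
  refine ⟨x, y, ?_⟩
  simp at h
  linear_combination h

theorem diagonal_fin_three (a b c : F) :
    Matrix.diagonal ![a, b, c] = !![a, 0, 0; 0, b, 0; 0, 0, c] := by
  ext i j
  fin_cases i <;> fin_cases j <;> rfl

/-- Take a vector (x, y) on which the form is 1. Its orthogonal complement in the plane is spanned
by (−by, ax), where the form is ab(ax² + by²) = ab. -/
theorem sim_diagonal_mul [Finite F] (h2 : (2 : F) ≠ 0) {a b : F} (ha : a ≠ 0) (hb : b ≠ 0)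
    (c : F) : Sim (Matrix.diagonal ![a, b, c]) (Matrix.diagonal ![1, a * b, c]) := by
  obtain ⟨x, y, h⟩ := exists_mul_sq_add_mul_sq_eq_one h2 ha hb
  refine ⟨!![x, y, 0; -(b * y), a * x, 0; 0, 0, 1], 1, ?_, one_ne_zero, ?_⟩
  · simp [Matrix.det_fin_three]
    intro h'
    apply one_ne_zero (α := F)
    linear_combination h' - h
  · rw [diagonal_fin_three, diagonal_fin_three]
    ext i j
    fin_cases i <;> fin_cases j <;> simp [Matrix.vecMul, dotProduct, Fin.sum_univ_three]
    · linear_combination -h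
    · ring
    · ring
    · linear_combination -(a * b) * h

/-- Nondegenerate ternary quadratic forms over a finite field of odd order are all similar. -/
theorem sim_one_of_det_ne_zero [Finite F] (h2 : (2 : F) ≠ 0) {S : Matrix (Fin 3) (Fin 3) F}
    (hS : S.IsSymm) (hd : S.det ≠ 0) : Sim 1 S := by
  obtain ⟨d, h⟩ := exists_sim_diagonal h2 hS
  refine Sim.trans (Sim.symm ?_) h
  have hd' := h.symm.det_ne_zero hd
  rw [Matrix.det_diagonal, Fin.prod_univ_three] at hd'
  have h01 : d 0 * d 1 ≠ 0 := left_ne_zero_of_mul hd'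
  have hd2 : d 2 ≠ 0 := right_ne_zero_of_mul hd'
  have e0 : Matrix.diagonal d = Matrix.diagonal ![d 0, d 1, d 2] := by
    congr 1
    funext i
    fin_cases i <;> rfl
  rw [e0]
  refine (sim_diagonal_mul h2 (left_ne_zero_of_mul h01) (right_ne_zero_of_mul h01) _).trans ?_
  refine (sim_diagonal_perm _ (finRotate 3)).trans ?_
  have e1 : (![1, d 0 * d 1, d 2] : Fin 3 → F) ∘ finRotate 3 = ![d 0 * d 1, d 2, 1] := by
    funext i
    fin_cases i <;> rfl
  rw [e1]
  refine (sim_diagonal_mul h2 h01 hd2 _).trans ?_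
  -- The form is now diag(1, p, 1). Odd dimension enters here: scaling by p and permuting gives
  -- diag(p, p, p²), merging the two entries p gives diag(1, p², p²), and only squares remain.
  set p := d 0 * d 1 * d 2 with hp
  refine (Sim.smul _ hd').trans ?_
  have e4 : p • Matrix.diagonal ![1, p, 1] = Matrix.diagonal ![p, p * p, p] := by
    rw [diagonal_fin_three, diagonal_fin_three]
    ext i j
    fin_cases i <;> fin_cases j <;> simp
  rw [e4]
  refine (sim_diagonal_perm _ (Equiv.swap 0 1)).trans ?_
  have e2 : (![p, p * p, p] : Fin 3 → F) ∘ Equiv.swap 0 1 = ![p * p, p, p] := by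
    funext i
    fin_cases i <;> simp [Equiv.swap_apply_def]
  rw [e2]
  refine (sim_diagonal_perm _ (finRotate 3)).trans ?_
  have e3 : (![p * p, p, p] : Fin 3 → F) ∘ finRotate 3 = ![p, p, p * p] := by
    funext i
    fin_cases i <;> rfl
  rw [e3]
  refine (sim_diagonal_mul h2 hd' hd' _).trans ?_
  refine (sim_diagonal_sq _ ![1, p⁻¹, p⁻¹] ?_).trans ?_
  · intro i
    fin_cases i <;> simp [hd']
  · rw [← Matrix.diagonal_one]
    convert Sim.refl _ using 2
    funext i
    fin_cases i <;> simp <;> field_simp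

theorem sim_of_det_ne_zero [Finite F] (h2 : (2 : F) ≠ 0) {S T : Matrix (Fin 3) (Fin 3) F}
    (hS : S.IsSymm) (hdS : S.det ≠ 0) (hT : T.IsSymm) (hdT : T.det ≠ 0) : Sim S T :=
  (sim_one_of_det_ne_zero h2 hS hdS).symm.trans (sim_one_of_det_ne_zero h2 hT hdT)

/-! ### The four types of symmetric matrices -/

/-- Representatives of the four classes of nonzero symmetric matrices (`ε` is a nonsquare). -/
def typeRep (ε : F) : Fin 4 → Matrix (Fin 3) (Fin 3) F :=
  ![!![1, 0, 0; 0, 0, 0; 0, 0, 0], !![0, 1, 0; 1, 0, 0; 0, 0, 0],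
    !![1, 0, 0; 0, -ε, 0; 0, 0, 0], !![0, 0, -1; 0, 2, 0; -1, 0, 0]]

/-- The matrix `S` is of type `t`. -/
def HasType (ε : F) (t : Fin 4) (S : Matrix (Fin 3) (Fin 3) F) : Prop := Sim (typeRep ε t) S

theorem isSymm_typeRep (ε : F) (t : Fin 4) : (typeRep ε t).IsSymm := by
  ext i j
  fin_cases t <;> fin_cases i <;> fin_cases j <;> rfl

theorem HasType.isSymm {ε : F} {t : Fin 4} {S : Matrix (Fin 3) (Fin 3) F} (h : HasType ε t S) :
    S.IsSymm :=
  Sim.isSymm h (isSymm_typeRep ε t)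

/-- The `3 × 3` matrix with given columns. -/
def colMat {R : Type*} (v w x : Fin 3 → R) : Matrix (Fin 3) (Fin 3) R :=
  !![v 0, w 0, x 0; v 1, w 1, x 1; v 2, w 2, x 2]

theorem eq_colMat {R : Type*} (A : Matrix (Fin 3) (Fin 3) R) : A = colMat (A.col 0) (A.col 1) (A.col 2) := by
  ext i j
  fin_cases i <;> fin_cases j <;> rfl

theorem det_colMat (v w x : Fin 3 → F) : (colMat v w x).det = x ⬝ᵥ (v ⨯₃ w) := by
  simp [colMat, Matrix.det_fin_three, cross_apply, dotProduct, Fin.sum_univ_three]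
  ring

/-- The determinant is the triple product of the columns, so a suitable third column exists exactly
when the cross product of the first two is nonzero. -/
theorem exists_det_colMat_ne_zero_iff {v w : Fin 3 → F} :
    (∃ x, (colMat v w x).det ≠ 0) ↔ LinearIndependent F ![v, w] := by
  simp_rw [← crossProduct_ne_zero_iff_linearIndependent, det_colMat]
  constructor
  · rintro ⟨x, hx⟩ h
    simp [h] at hx
  · intro h
    by_contra! h'
    exact h (dotProduct_eq_zero _ fun x => by rw [dotProduct_comm]; exact h' x)

/-! ### The singular types in terms of vectors -/

theorem colMat_congr_typeRep_zero (ε : F) (v w x : Fin 3 → F) :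
    colMat v w x * typeRep ε 0 * (colMat v w x)ᵀ = Matrix.vecMulVec v v := by
  ext i j
  fin_cases i <;> fin_cases j <;>
    simp [colMat, typeRep, Matrix.vecMul, dotProduct, Fin.sum_univ_three, Matrix.vecMulVec_apply]

theorem colMat_congr_typeRep_one (ε : F) (v w x : Fin 3 → F) :
    colMat v w x * typeRep ε 1 * (colMat v w x)ᵀ =
      Matrix.vecMulVec v w + Matrix.vecMulVec w v := by
  ext i j
  fin_cases i <;> fin_cases j <;>
    simp [colMat, typeRep, Matrix.vecMul, dotProduct, Fin.sum_univ_three,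
      Matrix.vecMulVec_apply] <;> ring

theorem colMat_congr_typeRep_two (ε : F) (v w x : Fin 3 → F) :
    colMat v w x * typeRep ε 2 * (colMat v w x)ᵀ =
      Matrix.vecMulVec v v - ε • Matrix.vecMulVec w w := by
  ext i j
  fin_cases i <;> fin_cases j <;>
    simp [colMat, typeRep, Matrix.vecMul, dotProduct, Fin.sum_univ_three,
      Matrix.vecMulVec_apply] <;> ring

theorem linearIndependent_of_det_ne_zero {A : Matrix (Fin 3) (Fin 3) F} (hA : A.det ≠ 0) :
    LinearIndependent F ![A.col 0, A.col 1] :=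
  exists_det_colMat_ne_zero_iff.1 ⟨A.col 2, by rwa [← eq_colMat]⟩

/-- The congruence image of a singular representative involves only the first column of the matrix
(here) or the first two (types 1 and 2), and any independent columns can be completed to an
invertible matrix. -/
theorem hasType_zero_iff {ε : F} {S : Matrix (Fin 3) (Fin 3) F} :
    HasType ε 0 S ↔ ∃ (c : F) (v : Fin 3 → F), c ≠ 0 ∧ v ≠ 0 ∧ S = c • Matrix.vecMulVec v v := by
  constructor
  · rintro ⟨A, c, hA, hc, rfl⟩
    refine ⟨c, A.col 0, hc, (linearIndependent_of_det_ne_zero hA).ne_zero 0, ?_⟩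
    rw [eq_colMat A, colMat_congr_typeRep_zero, ← eq_colMat]
  · rintro ⟨c, v, hc, hv, rfl⟩
    obtain ⟨w, hw⟩ := exists_linearIndependent_pair_of_one_lt_finrank (R := F) (by simp) hv
    obtain ⟨x, hx⟩ := exists_det_colMat_ne_zero_iff.2 hw
    exact ⟨_, c, hx, hc, by rw [colMat_congr_typeRep_zero]⟩

theorem hasType_one_iff {ε : F} {S : Matrix (Fin 3) (Fin 3) F} :
    HasType ε 1 S ↔ ∃ v w : Fin 3 → F, LinearIndependent F ![v, w] ∧
      S = Matrix.vecMulVec v w + Matrix.vecMulVec w v := by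
  constructor
  · rintro ⟨A, c, hA, hc, rfl⟩
    -- For a product of two vectors the scalar can be absorbed into one factor; for types 0 and 2 it
    -- has to stay.
    refine ⟨c • A.col 0, A.col 1, ?_, ?_⟩
    · have := linearIndependent_of_det_ne_zero hA
      rw [LinearIndependent.pair_iff] at this ⊢
      intro s t h
      obtain ⟨h1, h2⟩ := this (s * c) t (by rw [← h, smul_smul])
      exact ⟨(mul_eq_zero.1 h1).resolve_right hc, h2⟩
    · rw [eq_colMat A, colMat_congr_typeRep_one, ← eq_colMat, smul_add, Matrix.smul_vecMulVec,
        Matrix.vecMulVec_smul]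
  · rintro ⟨v, w, hw, rfl⟩
    obtain ⟨x, hx⟩ := exists_det_colMat_ne_zero_iff.2 hw
    exact ⟨_, 1, hx, one_ne_zero, by rw [colMat_congr_typeRep_one, one_smul]⟩

theorem hasType_two_iff {ε : F} {S : Matrix (Fin 3) (Fin 3) F} :
    HasType ε 2 S ↔ ∃ (c : F) (v w : Fin 3 → F), c ≠ 0 ∧ LinearIndependent F ![v, w] ∧
      S = c • (Matrix.vecMulVec v v - ε • Matrix.vecMulVec w w) := by
  constructor
  · rintro ⟨A, c, hA, hc, rfl⟩
    refine ⟨c, A.col 0, A.col 1, hc, linearIndependent_of_det_ne_zero hA, ?_⟩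
    rw [eq_colMat A, colMat_congr_typeRep_two, ← eq_colMat]
  · rintro ⟨c, v, w, hc, hw, rfl⟩
    obtain ⟨x, hx⟩ := exists_det_colMat_ne_zero_iff.2 hw
    exact ⟨_, c, hx, hc, by rw [colMat_congr_typeRep_two]⟩

theorem det_typeRep_three_ne_zero (h2 : (2 : F) ≠ 0) (ε : F) : (typeRep ε 3).det ≠ 0 := by
  simpa [typeRep, Matrix.det_fin_three] using h2

theorem hasType_three_iff [Finite F] (h2 : (2 : F) ≠ 0) {ε : F} {S : Matrix (Fin 3) (Fin 3) F}
    (hS : S.IsSymm) : HasType ε 3 S ↔ S.det ≠ 0 :=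
  ⟨fun h => Sim.det_ne_zero h (det_typeRep_three_ne_zero h2 ε), fun h =>
    sim_of_det_ne_zero h2 (isSymm_typeRep ε 3) (det_typeRep_three_ne_zero h2 ε) hS h⟩

theorem isSquare_mul_of_not_isSquare [Finite F] {a b : F} (ha : ¬IsSquare a) (hb : ¬IsSquare b) :
    IsSquare (a * b) := by
  classical
  have := Fintype.ofFinite F
  have ha0 : a ≠ 0 := fun h => ha (h ▸ IsSquare.zero)
  have hb0 : b ≠ 0 := fun h => hb (h ▸ IsSquare.zero)
  rw [← quadraticChar_one_iff_isSquare (mul_ne_zero ha0 hb0), map_mul,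
    quadraticChar_neg_one_iff_not_isSquare.2 ha, quadraticChar_neg_one_iff_not_isSquare.2 hb]
  norm_num

/-- This is X² − t²Y² = (X + tY)(X − tY); the factor 1/2 compensates for the symmetrization. -/
theorem vecMulVec_sub_sq (h2 : (2 : F) ≠ 0) (v w : Fin 3 → F) (t : F) :
    Matrix.vecMulVec v v - t ^ 2 • Matrix.vecMulVec w w =
      Matrix.vecMulVec ((2⁻¹ : F) • (v + t • w)) (v - t • w) +
        Matrix.vecMulVec (v - t • w) ((2⁻¹ : F) • (v + t • w)) := by
  ext i j
  simp [Matrix.vecMulVec_apply]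
  field_simp
  ring

/-- A combination of two squares is of one of the two types of rank two. -/
theorem hasType_of_rank_two [Finite F] (h2 : (2 : F) ≠ 0) {ε : F} (hε : ¬IsSquare ε) {a b : F}
    (ha : a ≠ 0) (hb : b ≠ 0) {v w : Fin 3 → F} (h : LinearIndependent F ![v, w]) :
    HasType ε 1 (a • Matrix.vecMulVec v v + b • Matrix.vecMulVec w w) ∨
      HasType ε 2 (a • Matrix.vecMulVec v v + b • Matrix.vecMulVec w w) := by
  have hε0 : ε ≠ 0 := fun h => hε (h ▸ IsSquare.zero)
  rw [LinearIndependent.pair_iff] at h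
  -- The form aX² + bY² splits into linear factors over `F` exactly when −b/a is a square.
  by_cases hsq : IsSquare (-(b / a))
  · left
    obtain ⟨t, ht⟩ := hsq
    have ht0 : t ≠ 0 := by
      rintro rfl
      simp [ha, hb] at ht
    have e : a • Matrix.vecMulVec v v + b • Matrix.vecMulVec w w =
        a • (Matrix.vecMulVec v v - t ^ 2 • Matrix.vecMulVec w w) := by
      rw [pow_two, ← ht, neg_smul, sub_neg_eq_add, smul_add, smul_smul, mul_div_cancel₀ _ ha]
    rw [e, vecMulVec_sub_sq h2 v w t]
    refine Sim.trans ?_ (Sim.smul _ ha)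
    refine hasType_one_iff.2 ⟨_, _, ?_, rfl⟩
    rw [LinearIndependent.pair_iff]
    intro r s hrs
    have := h (r * 2⁻¹ + s) (r * 2⁻¹ * t - s * t) (by rw [← hrs]; module)
    obtain ⟨h3, h4⟩ := this
    have h5 : r * 2⁻¹ - s = 0 := by
      apply mul_right_cancel₀ ht0
      linear_combination h4
    have h6 : r = 0 := by
      have : r * 2⁻¹ * 2 = r := by field_simp
      linear_combination h3 + h5 - this
    subst h6
    simpa using h3
  · right
    -- Two nonsquares have a square product t², so −b/a = ε(t/ε)², and rescaling `w` by t/ε turns b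
    -- into −aε.
    obtain ⟨t, ht⟩ := isSquare_mul_of_not_isSquare hsq hε
    have ht0 : t ≠ 0 := by
      rintro rfl
      simp [ha, hb, hε0] at ht
    refine hasType_two_iff.2 ⟨a, v, (t / ε) • w, ha, ?_, ?_⟩
    · rw [LinearIndependent.pair_iff]
      intro r s hrs
      have := h r (s * (t / ε)) (by rw [← hrs, smul_smul])
      refine ⟨this.1, (mul_eq_zero.1 this.2).resolve_right (div_ne_zero ht0 hε0)⟩
    · have hb' : b = -(a * (ε * (t / ε) * (t / ε))) := by
        field_simp
        field_simp at ht
        linear_combination -ht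
      rw [Matrix.smul_vecMulVec, Matrix.vecMulVec_smul, smul_smul, smul_smul, smul_sub, smul_smul]
      conv_lhs => rw [hb']
      rw [neg_smul, sub_eq_add_neg]

theorem diagonal_eq_sum_vecMulVec (d : Fin 3 → F) : Matrix.diagonal d =
    ∑ i, d i • Matrix.vecMulVec (Pi.single i 1) (Pi.single i 1) := by
  ext i j
  fin_cases i <;> fin_cases j <;> simp [Fin.sum_univ_three, Matrix.vecMulVec_apply]

theorem linearIndependent_single_pair {i j : Fin 3} (h : i ≠ j) :
    LinearIndependent F ![(Pi.single i 1 : Fin 3 → F), Pi.single j 1] := by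
  rw [LinearIndependent.pair_iff]
  intro s t hst
  exact ⟨by simpa [h] using congrFun hst i, by simpa [h.symm] using congrFun hst j⟩

/-- Every nonzero symmetric matrix has a type. -/
theorem exists_hasType [Finite F] (h2 : (2 : F) ≠ 0) {ε : F} (hε : ¬IsSquare ε)
    {S : Matrix (Fin 3) (Fin 3) F} (hS : S.IsSymm) (h0 : S ≠ 0) : ∃ t, HasType ε t S := by
  by_cases hdet : S.det = 0
  swap
  · exact ⟨3, (hasType_three_iff h2 hS).2 hdet⟩
  obtain ⟨d, hd⟩ := exists_sim_diagonal h2 hS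
  suffices ∃ t, HasType ε t (Matrix.diagonal d) by
    obtain ⟨t, ht⟩ := this
    exact ⟨t, Sim.trans ht hd⟩
  have hdd : (Matrix.diagonal d).det = 0 := by
    by_contra h
    exact hd.det_ne_zero h hdet
  rw [Matrix.det_diagonal, Finset.prod_eq_zero_iff] at hdd
  obtain ⟨k, -, hk⟩ := hdd
  -- A vanishing determinant kills one diagonal entry, so at most two squares survive.
  obtain ⟨i, j, hij, hsum⟩ : ∃ i j : Fin 3, i ≠ j ∧ Matrix.diagonal d =
      d i • Matrix.vecMulVec (Pi.single i 1) (Pi.single i 1) +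
        d j • Matrix.vecMulVec (Pi.single j 1) (Pi.single j 1) := by
    rw [diagonal_eq_sum_vecMulVec, Fin.sum_univ_three]
    fin_cases k
    · exact ⟨1, 2, by decide, by simp at hk; simp [hk]⟩
    · exact ⟨0, 2, by decide, by simp at hk; simp [hk]⟩
    · exact ⟨0, 1, by decide, by simp at hk; simp [hk]⟩
  rw [hsum]
  by_cases hi : d i = 0
  · by_cases hj : d j = 0
    · refine absurd ?_ h0
      obtain ⟨A, c, -, -, rfl⟩ := hd
      rw [hsum, hi, hj]
      simp
    · refine ⟨0, hasType_zero_iff.2 ⟨d j, Pi.single j 1, hj, ?_, by simp [hi]⟩⟩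
      simp
  · by_cases hj : d j = 0
    · refine ⟨0, hasType_zero_iff.2 ⟨d i, Pi.single i 1, hi, ?_, by simp [hj]⟩⟩
      simp
    · rcases hasType_of_rank_two h2 hε hi hj (linearIndependent_single_pair hij) with h | h
      · exact ⟨1, h⟩
      · exact ⟨2, h⟩

/-! ### Kernels and isotropic vectors -/

/-- The number of vectors in the kernel of `S`. -/
noncomputable def kerCard (S : Matrix (Fin 3) (Fin 3) F) : ℕ := Nat.card {x // S *ᵥ x = 0}

/-- The number of isotropic vectors of `S`. -/
noncomputable def isoCard (S : Matrix (Fin 3) (Fin 3) F) : ℕ := Nat.card {x // x ⬝ᵥ S *ᵥ x = 0}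

/-- Multiplication by an invertible matrix as a permutation of the vectors. -/
noncomputable def mulVecEquiv (A : Matrix (Fin 3) (Fin 3) F) (hA : A.det ≠ 0) :
    (Fin 3 → F) ≃ (Fin 3 → F) where
  toFun x := A *ᵥ x
  invFun x := A⁻¹ *ᵥ x
  left_inv x := by
    change A⁻¹ *ᵥ (A *ᵥ x) = x
    rw [Matrix.mulVec_mulVec, Matrix.nonsing_inv_mul _ (isUnit_iff_ne_zero.2 hA),
      Matrix.one_mulVec]
  right_inv x := by
    change A *ᵥ (A⁻¹ *ᵥ x) = x
    rw [Matrix.mulVec_mulVec, Matrix.mul_nonsing_inv _ (isUnit_iff_ne_zero.2 hA),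
      Matrix.one_mulVec]

/-- The substitution x ↦ Aᵀx carries the kernel of cAMAᵀ onto that of M; the same substitution
serves for isotropic vectors. -/
theorem Sim.kerCard_eq {M N : Matrix (Fin 3) (Fin 3) F} (h : Sim M N) :
    kerCard N = kerCard M := by
  obtain ⟨A, c, hA, hc, rfl⟩ := h
  refine Nat.card_congr ((mulVecEquiv Aᵀ (by rwa [Matrix.det_transpose])).subtypeEquiv ?_)
  intro x
  change _ ↔ M *ᵥ (Aᵀ *ᵥ x) = 0
  rw [Matrix.smul_mulVec, smul_eq_zero_iff_right hc, ← Matrix.mulVec_mulVec,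
    ← Matrix.mulVec_mulVec]
  constructor
  · intro h
    apply (mulVecEquiv A hA).injective
    change A *ᵥ _ = A *ᵥ 0
    rw [h, Matrix.mulVec_zero]
  · intro h
    rw [h, Matrix.mulVec_zero]

theorem Sim.isoCard_eq {M N : Matrix (Fin 3) (Fin 3) F} (h : Sim M N) :
    isoCard N = isoCard M := by
  obtain ⟨A, c, hA, hc, rfl⟩ := h
  refine Nat.card_congr ((mulVecEquiv Aᵀ (by rwa [Matrix.det_transpose])).subtypeEquiv ?_)
  intro x
  change _ ↔ (Aᵀ *ᵥ x) ⬝ᵥ M *ᵥ (Aᵀ *ᵥ x) = 0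
  rw [Matrix.smul_mulVec, dotProduct_smul, smul_eq_zero_iff_right hc, ← Matrix.mulVec_mulVec,
    ← Matrix.mulVec_mulVec, Matrix.dotProduct_mulVec x A, Matrix.mulVec_transpose]

/-! ### Counting solution sets by injective parametrizations -/

theorem card_subtype_of_param {α β : Type*} {p : β → Prop} (f : α → β)
    (hf : Function.Injective f) (h : ∀ b, p b ↔ ∃ a, f a = b) :
    Nat.card {b // p b} = Nat.card α := by
  rw [Nat.card_congr (Equiv.ofInjective f hf)]
  exact Nat.card_congr (Equiv.subtypeEquivRight h)

theorem card_vec_fst_eq_zero [Finite F] :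
    Nat.card {x : Fin 3 → F // x 0 = 0} = Nat.card F ^ 2 := by
  rw [card_subtype_of_param (fun p : F × F => ![0, p.1, p.2]), Nat.card_prod, pow_two]
  · rintro ⟨a, b⟩ ⟨c, d⟩ h
    have h1 := congrFun h 1
    have h2 := congrFun h 2
    simp at h1 h2
    simp [h1, h2]
  · intro x
    constructor
    · intro h
      refine ⟨(x 1, x 2), ?_⟩
      funext i
      fin_cases i <;> simp [h]
    · rintro ⟨p, rfl⟩
      rfl

theorem card_vec_fst_snd_eq_zero [Finite F] :
    Nat.card {x : Fin 3 → F // x 0 = 0 ∧ x 1 = 0} = Nat.card F := by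
  rw [card_subtype_of_param (fun p : F => ![0, 0, p])]
  · intro a b h
    simpa using congrFun h 2
  · intro x
    constructor
    · intro h
      refine ⟨x 2, ?_⟩
      funext i
      fin_cases i <;> simp [h]
    · rintro ⟨p, rfl⟩
      exact ⟨rfl, rfl⟩

theorem card_vec_mul_eq_zero [Finite F] :
    Nat.card {x : Fin 3 → F // x 0 * x 1 = 0} =
      Nat.card F ^ 2 + (Nat.card F - 1) * Nat.card F := by
  rw [card_subtype_of_param (α := F × F ⊕ Fˣ × F)
    (Sum.elim (fun p => ![0, p.1, p.2]) (fun p => ![(p.1 : F), 0, p.2])), Nat.card_sum,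
    Nat.card_prod, Nat.card_prod, pow_two, Nat.card_units]
  · rintro (⟨a, b⟩ | ⟨a, b⟩) (⟨c, d⟩ | ⟨c, d⟩) h
    all_goals
      have h0 := congrFun h 0
      have h1 := congrFun h 1
      have h2 := congrFun h 2
      simp at h0 h1 h2 <;>
        first | exact absurd h0.symm (Units.ne_zero _) | simp_all [Units.ext_iff]
  · intro x
    constructor
    · intro h
      by_cases h0 : x 0 = 0
      · refine ⟨Sum.inl (x 1, x 2), ?_⟩
        funext i
        fin_cases i <;> simp [h0]
      · have h1 := (mul_eq_zero.1 h).resolve_left h0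
        refine ⟨Sum.inr (Units.mk0 _ h0, x 2), ?_⟩
        funext i
        fin_cases i <;> simp [h1]
    · rintro ⟨⟨a, b⟩ | ⟨a, b⟩, rfl⟩ <;> simp

/-- If x₀ = 0 then x₁ = 0 and x₂ is free; if x₀ ≠ 0 then x₁ is free and determines x₂. This gives q
+ (q − 1)q. -/
theorem card_vec_sq_eq_mul [Finite F] :
    Nat.card {x : Fin 3 → F // x 1 ^ 2 = x 0 * x 2} = Nat.card F ^ 2 := by
  rw [card_subtype_of_param (α := F ⊕ Fˣ × F)
    (Sum.elim (fun p => ![0, 0, p]) (fun p => ![(p.1 : F), p.2, p.2 ^ 2 / p.1])), Nat.card_sum,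
    Nat.card_prod, Nat.card_units]
  · have : 1 ≤ Nat.card F := Nat.card_pos
    zify [this]
    ring
  · rintro (a | ⟨a, b⟩) (c | ⟨c, d⟩) h
    all_goals
      have h0 := congrFun h 0
      have h1 := congrFun h 1
      have h2 := congrFun h 2
      simp at h0 h1 h2 <;>
        first | exact absurd h0.symm (Units.ne_zero _) | simp_all [Units.ext_iff]
  · intro x
    constructor
    · intro h
      by_cases h0 : x 0 = 0
      · rw [h0, zero_mul, sq_eq_zero_iff] at h
        refine ⟨Sum.inl (x 2), ?_⟩
        funext i
        fin_cases i <;> simp [h0, h]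
      · refine ⟨Sum.inr (Units.mk0 _ h0, x 1), ?_⟩
        funext i
        fin_cases i <;> simp
        field_simp
        exact h
    · rintro ⟨a | ⟨a, b⟩, rfl⟩
      · simp
      · simp
        field_simp

/-- A nonsquare multiple of a square is a square only trivially. -/
theorem sq_eq_mul_sq_iff {ε : F} (hε : ¬IsSquare ε) {x y : F} :
    x ^ 2 = ε * y ^ 2 ↔ x = 0 ∧ y = 0 := by
  constructor
  · intro h
    by_cases hy : y = 0
    · subst hy
      simpa using h
    · refine absurd ⟨x / y, ?_⟩ hε
      field_simp
      exact h.symm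
  · rintro ⟨rfl, rfl⟩
    simp

theorem HasType.isoCard_eq_zero [Finite F] {ε : F} {S : Matrix (Fin 3) (Fin 3) F}
    (h : HasType ε 0 S) : isoCard S = Nat.card F ^ 2 := by
  rw [Sim.isoCard_eq h, ← card_vec_fst_eq_zero]
  refine Nat.card_congr (Equiv.subtypeEquivRight fun x => ?_)
  simp [typeRep, dotProduct, Fin.sum_univ_three, Matrix.mulVec]

theorem HasType.isoCard_eq_one [Finite F] (h2 : (2 : F) ≠ 0) {ε : F}
    {S : Matrix (Fin 3) (Fin 3) F} (h : HasType ε 1 S) :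
    isoCard S = Nat.card F ^ 2 + (Nat.card F - 1) * Nat.card F := by
  rw [Sim.isoCard_eq h, ← card_vec_mul_eq_zero]
  refine Nat.card_congr (Equiv.subtypeEquivRight fun x => ?_)
  have : x ⬝ᵥ typeRep ε 1 *ᵥ x = 2 * (x 0 * x 1) := by
    simp [typeRep, dotProduct, Fin.sum_univ_three, Matrix.mulVec]
    ring
  rw [this, mul_eq_zero_iff_left h2]

theorem HasType.isoCard_eq_two [Finite F] {ε : F} (hε : ¬IsSquare ε)
    {S : Matrix (Fin 3) (Fin 3) F} (h : HasType ε 2 S) : isoCard S = Nat.card F := by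
  rw [Sim.isoCard_eq h, ← card_vec_fst_snd_eq_zero]
  refine Nat.card_congr (Equiv.subtypeEquivRight fun x => ?_)
  have : x ⬝ᵥ typeRep ε 2 *ᵥ x = x 0 ^ 2 - ε * x 1 ^ 2 := by
    simp [typeRep, dotProduct, Fin.sum_univ_three, Matrix.mulVec]
    ring
  rw [this, sub_eq_zero, sq_eq_mul_sq_iff hε]

/-- The representative of rank three has the form 2(x₁² − x₀x₂), whose zeros are easy to
parametrize. -/
theorem HasType.isoCard_eq_three [Finite F] (h2 : (2 : F) ≠ 0) {ε : F}
    {S : Matrix (Fin 3) (Fin 3) F} (h : HasType ε 3 S) : isoCard S = Nat.card F ^ 2 := by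
  rw [Sim.isoCard_eq h, ← card_vec_sq_eq_mul]
  refine Nat.card_congr (Equiv.subtypeEquivRight fun x => ?_)
  have : x ⬝ᵥ typeRep ε 3 *ᵥ x = 2 * (x 1 ^ 2 - x 0 * x 2) := by
    simp [typeRep, dotProduct, Fin.sum_univ_three, Matrix.mulVec]
    ring
  rw [this, mul_eq_zero_iff_left h2, sub_eq_zero]

theorem HasType.kerCard_eq_zero [Finite F] {ε : F} {S : Matrix (Fin 3) (Fin 3) F}
    (h : HasType ε 0 S) : kerCard S = Nat.card F ^ 2 := by
  rw [Sim.kerCard_eq h, ← card_vec_fst_eq_zero]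
  refine Nat.card_congr (Equiv.subtypeEquivRight fun x => ?_)
  simp [typeRep, funext_iff, Fin.forall_fin_succ, Matrix.vecHead, Matrix.vecTail]

theorem HasType.kerCard_eq_one [Finite F] {ε : F} {S : Matrix (Fin 3) (Fin 3) F}
    (h : HasType ε 1 S) : kerCard S = Nat.card F := by
  rw [Sim.kerCard_eq h, ← card_vec_fst_snd_eq_zero]
  refine Nat.card_congr (Equiv.subtypeEquivRight fun x => ?_)
  simp [typeRep, funext_iff, Fin.forall_fin_succ, Matrix.vecHead, Matrix.vecTail]
  exact and_comm

theorem HasType.kerCard_eq_two [Finite F] {ε : F} (hε : ¬IsSquare ε)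
    {S : Matrix (Fin 3) (Fin 3) F} (h : HasType ε 2 S) : kerCard S = Nat.card F := by
  have hε0 : ε ≠ 0 := fun h => hε (h ▸ IsSquare.zero)
  rw [Sim.kerCard_eq h, ← card_vec_fst_snd_eq_zero]
  refine Nat.card_congr (Equiv.subtypeEquivRight fun x => ?_)
  simp [typeRep, funext_iff, Fin.forall_fin_succ, Matrix.vecHead, Matrix.vecTail, hε0]

theorem HasType.kerCard_eq_three [Finite F] (h2 : (2 : F) ≠ 0) {ε : F}
    {S : Matrix (Fin 3) (Fin 3) F} (h : HasType ε 3 S) : kerCard S = 1 := by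
  rw [Sim.kerCard_eq h, ← Nat.card_unique (α := Unit)]
  refine card_subtype_of_param (fun _ => 0) (fun _ _ _ => rfl) fun x => ?_
  constructor
  · intro h
    refine ⟨(), ?_⟩
    have h0 := congrFun h 0
    have h1 := congrFun h 1
    have h3 := congrFun h 2
    simp [typeRep, Matrix.vecHead, Matrix.vecTail, h2] at h0 h1 h3
    funext i
    fin_cases i <;> simp [h0, h1, h3]
  · rintro ⟨-, rfl⟩
    simp

/-- The types are mutually exclusive. -/
theorem HasType.unique [Finite F] (h2 : (2 : F) ≠ 0) {ε : F} (hε : ¬IsSquare ε)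
    {S : Matrix (Fin 3) (Fin 3) F} {s t : Fin 4} (hs : HasType ε s S) (ht : HasType ε t S) :
    s = t := by
  have hq : 1 < Nat.card F := Finite.one_lt_card
  have e1 : Nat.card F ^ 2 ≠ Nat.card F := by nlinarith
  have e2 : Nat.card F ^ 2 + (Nat.card F - 1) * Nat.card F ≠ Nat.card F := by nlinarith
  have e3 : Nat.card F ^ 2 ≠ 1 := by nlinarith
  -- Kernel sizes q², q, q, 1 separate all types except 1 and 2, which are told apart by their
  -- isotropic vectors.
  have key : ∀ s t : Fin 4, s < t → HasType ε s S → HasType ε t S → False := by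
    intro s t hst hs ht
    fin_cases s <;> fin_cases t <;> simp at hst
    · exact e1 (hs.kerCard_eq_zero.symm.trans ht.kerCard_eq_one)
    · exact e1 (hs.kerCard_eq_zero.symm.trans (ht.kerCard_eq_two hε))
    · exact e3 (hs.kerCard_eq_zero.symm.trans (ht.kerCard_eq_three h2))
    · exact e2 ((hs.isoCard_eq_one h2).symm.trans (ht.isoCard_eq_two hε))
    · exact hq.ne' (hs.kerCard_eq_one.symm.trans (ht.kerCard_eq_three h2))
    · exact hq.ne' ((hs.kerCard_eq_two hε).symm.trans (ht.kerCard_eq_three h2))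
  rcases lt_trichotomy s t with h | h | h
  · exact (key s t h hs ht).elim
  · exact h
  · exact (key t s h ht hs).elim

/-- The type of a matrix is an invariant of its class. -/
theorem HasType.sim_iff {ε : F} {S T : Matrix (Fin 3) (Fin 3) F} {t : Fin 4}
    (hs : HasType ε t S) : Sim S T ↔ HasType ε t T :=
  ⟨fun h => Sim.trans hs h, fun h => Sim.trans (Sim.symm hs) h⟩

theorem HasType.ne_zero (h2 : (2 : F) ≠ 0) {ε : F} {S : Matrix (Fin 3) (Fin 3) F} {t : Fin 4}
    (hs : HasType ε t S) : S ≠ 0 := by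
  rintro rfl
  obtain ⟨A, c, hA, hc, h⟩ := Sim.symm hs
  simp only [Matrix.mul_zero, Matrix.zero_mul, smul_zero] at h
  fin_cases t
  · simpa [typeRep] using congrFun (congrFun h 0) 0
  · simpa [typeRep] using congrFun (congrFun h 0) 1
  · simpa [typeRep] using congrFun (congrFun h 0) 0
  · simpa [typeRep, h2] using congrFun (congrFun h 1) 1

/-- The rank of a matrix from the size of its kernel. -/
theorem card_pow_rank_mul_kerCard [Finite F] (S : Matrix (Fin 3) (Fin 3) F) :
    Nat.card F ^ S.rank * kerCard S = Nat.card F ^ 3 := by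
  have h1 : kerCard S = Nat.card F ^ Module.finrank F (LinearMap.ker S.mulVecLin) :=
    Module.natCard_eq_pow_finrank (K := F) (V := LinearMap.ker S.mulVecLin)
  rw [h1, ← pow_add, Matrix.rank, LinearMap.finrank_range_add_finrank_ker]
  simp

theorem rank_eq_of_kerCard [Finite F] {S : Matrix (Fin 3) (Fin 3) F} {k r : ℕ}
    (h : kerCard S = Nat.card F ^ k) (hr : r + k = 3) : S.rank = r := by
  have h1 := card_pow_rank_mul_kerCard S
  rw [h, ← pow_add] at h1
  have := Nat.pow_right_injective (Finite.one_lt_card (α := F)) h1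
  omega

theorem HasType.rank_eq [Finite F] (h2 : (2 : F) ≠ 0) {ε : F} (hε : ¬IsSquare ε)
    {S : Matrix (Fin 3) (Fin 3) F} {t : Fin 4} (h : HasType ε t S) :
    S.rank = ![1, 2, 2, 3] t := by
  fin_cases t
  · exact rank_eq_of_kerCard h.kerCard_eq_zero rfl
  · exact rank_eq_of_kerCard (h.kerCard_eq_one.trans (pow_one _).symm) rfl
  · exact rank_eq_of_kerCard ((h.kerCard_eq_two hε).trans (pow_one _).symm) rfl
  · exact rank_eq_of_kerCard ((h.kerCard_eq_three h2).trans (pow_zero _).symm) rfl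

/-! ### Coordinate vectors and symmetric matrices -/

/-- The symmetric matrix (twice the Gram matrix) of the quadratic form with coefficients `a`. -/
def dualMat (a : Fin 6 → F) : Matrix (Fin 3) (Fin 3) F :=
  !![2 * a 0, a 1, a 2; a 1, 2 * a 3, a 4; a 2, a 4, 2 * a 5]

/-- The coordinates of the symmetric matrix `v wᵀ + w vᵀ`. -/
def symVec (v w : Fin 3 → F) : Fin 6 → F :=
  ![2 * (v 0 * w 0), v 0 * w 1 + v 1 * w 0, v 0 * w 2 + v 2 * w 0, 2 * (v 1 * w 1),
    v 1 * w 2 + v 2 * w 1, 2 * (v 2 * w 2)]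

/-- The coefficients of the product of two linear forms. -/
def prodVec (v w : Fin 3 → F) : Fin 6 → F :=
  ![v 0 * w 0, v 0 * w 1 + v 1 * w 0, v 0 * w 2 + v 2 * w 0, v 1 * w 1,
    v 1 * w 2 + v 2 * w 1, v 2 * w 2]

theorem isSymm_dualMat (a : Fin 6 → F) : (dualMat a).IsSymm := by
  ext i j
  fin_cases i <;> fin_cases j <;> rfl

theorem isSymm_symMat {R : Type*} (y : Fin 6 → R) : (symMat y).IsSymm := by
  ext i j
  fin_cases i <;> fin_cases j <;> rfl

theorem symMat_injective {R : Type*} : Function.Injective (symMat : (Fin 6 → R) → _) := by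
  intro x y h
  funext i
  fin_cases i
  · exact congrFun (congrFun h 0) 0
  · exact congrFun (congrFun h 0) 1
  · exact congrFun (congrFun h 0) 2
  · exact congrFun (congrFun h 1) 1
  · exact congrFun (congrFun h 1) 2
  · exact congrFun (congrFun h 2) 2

theorem symMat_upperEntries {R : Type*} {M : Matrix (Fin 3) (Fin 3) R} (hM : M.IsSymm) :
    symMat (upperEntries M) = M := by
  ext i j
  fin_cases i <;> fin_cases j <;> simp [symMat, upperEntries, hM.apply 0 1, hM.apply 0 2, hM.apply 1 2]

theorem dualMat_injective (h2 : (2 : F) ≠ 0) :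
    Function.Injective (dualMat : (Fin 6 → F) → _) := by
  intro x y h
  funext i
  fin_cases i
  · exact mul_left_cancel₀ h2 (congrFun (congrFun h 0) 0)
  · exact congrFun (congrFun h 0) 1
  · exact congrFun (congrFun h 0) 2
  · exact mul_left_cancel₀ h2 (congrFun (congrFun h 1) 1)
  · exact congrFun (congrFun h 1) 2
  · exact mul_left_cancel₀ h2 (congrFun (congrFun h 2) 2)

theorem exists_dualMat_eq (h2 : (2 : F) ≠ 0) {S : Matrix (Fin 3) (Fin 3) F} (hS : S.IsSymm) :
    ∃ a, dualMat a = S := by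
  refine ⟨![S 0 0 / 2, S 0 1, S 0 2, S 1 1 / 2, S 1 2, S 2 2 / 2], ?_⟩
  ext i j
  fin_cases i <;> fin_cases j <;> simp [dualMat, hS.apply 0 1, hS.apply 0 2, hS.apply 1 2] <;>
    field_simp

theorem symMat_smul (c : F) (y : Fin 6 → F) : symMat (c • y) = c • symMat y := by
  ext i j
  fin_cases i <;> fin_cases j <;> simp [symMat]

theorem symMat_add (x y : Fin 6 → F) : symMat (x + y) = symMat x + symMat y := by
  ext i j
  fin_cases i <;> fin_cases j <;> simp [symMat]

theorem symMat_zero : symMat (0 : Fin 6 → F) = 0 := by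
  ext i j
  fin_cases i <;> fin_cases j <;> simp [symMat]

theorem dualMat_smul (c : F) (a : Fin 6 → F) : dualMat (c • a) = c • dualMat a := by
  ext i j
  fin_cases i <;> fin_cases j <;> simp [dualMat] <;> ring

theorem dualMat_zero : dualMat (0 : Fin 6 → F) = 0 := by
  ext i j
  fin_cases i <;> fin_cases j <;> simp [dualMat]

theorem symMat_veroneseVec (v : Fin 3 → F) : symMat (veroneseVec v) = Matrix.vecMulVec v v := by
  ext i j
  fin_cases i <;> fin_cases j <;> simp [symMat, veroneseVec, Matrix.vecMulVec_apply] <;> ring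

theorem symMat_symVec (v w : Fin 3 → F) :
    symMat (symVec v w) = Matrix.vecMulVec v w + Matrix.vecMulVec w v := by
  ext i j
  fin_cases i <;> fin_cases j <;> simp [symMat, symVec, Matrix.vecMulVec_apply] <;> ring

theorem dualMat_prodVec (v w : Fin 3 → F) :
    dualMat (prodVec v w) = Matrix.vecMulVec v w + Matrix.vecMulVec w v := by
  ext i j
  fin_cases i <;> fin_cases j <;> simp [dualMat, prodVec, Matrix.vecMulVec_apply] <;> ring

theorem det_dualMat (a : Fin 6 → F) : (dualMat a).det = 2 * disc a := by
  simp [dualMat, Matrix.det_fin_three, disc]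
  ring

/-- Incidence becomes the trace form on symmetric matrices, from which the action on hyperplanes can
be read off. -/
theorem trace_dualMat_mul_symMat (a y : Fin 6 → F) :
    (dualMat a * symMat y).trace = 2 * (a ⬝ᵥ y) := by
  simp [dualMat, symMat, Matrix.trace_fin_three, dotProduct, Fin.sum_univ_six]
  ring

/-- For fixed vectors, orthogonality with respect to the form is a linear condition on its
coefficients; this makes the double counts possible. -/
theorem dotProduct_dualMat_mulVec (a : Fin 6 → F) (v w : Fin 3 → F) :
    v ⬝ᵥ dualMat a *ᵥ w = a ⬝ᵥ symVec v w := by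
  simp [dualMat, symVec, dotProduct, Fin.sum_univ_six, Fin.sum_univ_three, Matrix.mulVec]
  ring

theorem symVec_self (v : Fin 3 → F) : symVec v v = (2 : F) • veroneseVec v := by
  funext i
  fin_cases i <;> simp [symVec, veroneseVec, pow_two, mul_comm, two_mul]

/-- Consequently the hyperplane of a double line contains `y` exactly when the vector of the line is
isotropic for `symMat y`. -/
theorem prodVec_dotProduct (v : Fin 3 → F) (y : Fin 6 → F) :
    prodVec v v ⬝ᵥ y = v ⬝ᵥ symMat y *ᵥ v := by
  simp [symMat, prodVec, dotProduct, Fin.sum_univ_six, Fin.sum_univ_three, Matrix.mulVec]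
  ring

theorem isoCard_dualMat (h2 : (2 : F) ≠ 0) (a : Fin 6 → F) :
    isoCard (dualMat a) = Nat.card {v : Fin 3 → F // a ⬝ᵥ veroneseVec v = 0} := by
  refine Nat.card_congr (Equiv.subtypeEquivRight fun v => ?_)
  rw [dotProduct_dualMat_mulVec, symVec_self, dotProduct_smul, smul_eq_zero_iff_right h2]

/-! ### Counting vectors orthogonal to given vectors -/

theorem card_ker_mul_card [Finite F] {V : Type*} [AddCommGroup V] [Module F V] [Finite V]
    {φ : V →ₗ[F] F} (h : φ ≠ 0) : Nat.card (LinearMap.ker φ) * Nat.card F = Nat.card V := by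
  rw [Module.natCard_eq_pow_finrank (K := F) (V := V),
    Module.natCard_eq_pow_finrank (K := F) (V := LinearMap.ker φ), ← pow_succ,
    ← LinearMap.finrank_range_add_finrank_ker φ,
    LinearMap.range_eq_top.2 (LinearMap.surjective h), finrank_top, Module.finrank_self, add_comm]

/-- The linear functional `a ↦ a ⬝ᵥ y`. -/
def dotLin {n : ℕ} (y : Fin n → F) : (Fin n → F) →ₗ[F] F where
  toFun a := a ⬝ᵥ y
  map_add' a b := add_dotProduct a b y
  map_smul' c a := smul_dotProduct c a y

theorem dotLin_ne_zero {n : ℕ} {y : Fin n → F} (h : y ≠ 0) : dotLin y ≠ 0 := by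
  intro h'
  refine h (dotProduct_eq_zero _ fun a => ?_)
  rw [dotProduct_comm]
  exact LinearMap.congr_fun h' a

theorem card_dotProduct_eq_zero [Finite F] {n : ℕ} {y : Fin (n + 1) → F} (h : y ≠ 0) :
    Nat.card {a : Fin (n + 1) → F // a ⬝ᵥ y = 0} = Nat.card F ^ n := by
  have h1 := card_ker_mul_card (dotLin_ne_zero h)
  rw [Nat.card_fun, Nat.card_fin, pow_succ] at h1
  exact Nat.eq_of_mul_eq_mul_right Nat.card_pos h1

theorem mem_span_of_dotProduct {n : ℕ} {y b : Fin n → F}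
    (h : ∀ a, a ⬝ᵥ y = 0 → a ⬝ᵥ b = 0) : b ∈ Submodule.span F {y} := by
  have key : dotLin b ∈ Submodule.span F (Set.range fun _ : Unit => dotLin y) := by
    refine mem_span_of_iInf_ker_le_ker fun a ha => ?_
    simp only [Submodule.mem_iInf, LinearMap.mem_ker] at ha ⊢
    exact h a (ha ())
  rw [Set.range_const, Submodule.mem_span_singleton] at key
  obtain ⟨c, hc⟩ := key
  rw [Submodule.mem_span_singleton]
  refine ⟨c, ?_⟩
  funext i
  have := LinearMap.congr_fun hc (Pi.single i 1)
  simpa [dotLin] using this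

/-- On the hyperplane orthogonal to `y`, the functional of `b` is nonzero because `b` is not a
multiple of `y`, so it divides the count by q once more. -/
theorem card_dotProduct_pair_eq_zero [Finite F] {n : ℕ} {y b : Fin (n + 2) → F} (h : y ≠ 0)
    (hb : b ∉ Submodule.span F {y}) :
    Nat.card {a : Fin (n + 2) → F // a ⬝ᵥ y = 0 ∧ a ⬝ᵥ b = 0} = Nat.card F ^ n := by
  let W := LinearMap.ker (dotLin y)
  have h0 : (dotLin b).comp W.subtype ≠ 0 := by
    intro h'
    exact hb (mem_span_of_dotProduct fun a ha => LinearMap.congr_fun h' ⟨a, ha⟩)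
  have h1 := card_ker_mul_card h0
  have h3 : Nat.card W = Nat.card F ^ (n + 1) := card_dotProduct_eq_zero h
  rw [h3, pow_succ] at h1
  rw [← Nat.eq_of_mul_eq_mul_right Nat.card_pos h1]
  exact Nat.card_congr (Equiv.subtypeSubtypeEquivSubtypeInter (fun a : Fin (n + 2) → F => a ∈ W)
    (fun a => a ⬝ᵥ b = 0)).symm

/-- Double counting of the orthogonality relation between the vectors orthogonal to `y` and a
family of vectors. -/
theorem sum_card_orthogonal [Fintype F] [DecidableEq F] {B : Type*} [Finite B] {y : Fin 6 → F}
    (hy : y ≠ 0) (f : B → Fin 6 → F) :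
    ∑ a : Fin 6 → F with a ⬝ᵥ y = 0, (Nat.card {b // a ⬝ᵥ f b = 0} : ℚ) =
      Nat.card B * (Nat.card F : ℚ) ^ 4 + Nat.card {b // f b ∈ Submodule.span F {y}} *
        ((Nat.card F : ℚ) ^ 5 - (Nat.card F : ℚ) ^ 4) := by
  classical
  have := Fintype.ofFinite B
  have h1 : ∑ a : Fin 6 → F with a ⬝ᵥ y = 0, (Nat.card {b // a ⬝ᵥ f b = 0} : ℚ) =
      ∑ b : B, (Nat.card {a : Fin 6 → F // a ⬝ᵥ y = 0 ∧ a ⬝ᵥ f b = 0} : ℚ) := by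
    simp only [Nat.card_eq_fintype_card, Fintype.card_subtype]
    norm_cast
    have := Finset.sum_card_bipartiteAbove_eq_sum_card_bipartiteBelow
      (s := {a : Fin 6 → F | a ⬝ᵥ y = 0}) (t := (Finset.univ : Finset B))
      (fun a b => a ⬝ᵥ f b = 0)
    simpa only [Finset.bipartiteAbove, Finset.bipartiteBelow, Finset.filter_filter] using this
  -- The two linear conditions on `a` cut out q⁴ vectors, or q⁵ if the second follows from the
  -- first.
  have h3 : ∀ b : B, (Nat.card {a : Fin 6 → F // a ⬝ᵥ y = 0 ∧ a ⬝ᵥ f b = 0} : ℚ) =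
      (Nat.card F : ℚ) ^ 4 + if f b ∈ Submodule.span F {y} then
        ((Nat.card F : ℚ) ^ 5 - (Nat.card F : ℚ) ^ 4) else 0 := by
    intro b
    split_ifs with hb
    · have : Nat.card {a : Fin 6 → F // a ⬝ᵥ y = 0 ∧ a ⬝ᵥ f b = 0} = Nat.card F ^ 5 := by
        rw [← card_dotProduct_eq_zero hy]
        refine Nat.card_congr (Equiv.subtypeEquivRight fun a => and_iff_left_of_imp fun ha => ?_)
        obtain ⟨c, hc⟩ := Submodule.mem_span_singleton.1 hb
        rw [← hc, dotProduct_smul, ha, smul_zero]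
      rw [this]
      push_cast
      ring
    · rw [card_dotProduct_pair_eq_zero hy hb]
      simp
  rw [h1, Finset.sum_congr rfl fun b _ => h3 b, Finset.sum_add_distrib, ← Finset.sum_filter,
    Finset.sum_const, Finset.sum_const, nsmul_eq_mul, nsmul_eq_mul, Finset.card_univ,
    ← Nat.card_eq_fintype_card, Nat.card_eq_fintype_card (α := {b // _}), Fintype.card_subtype]

/-- The number of pairs of vectors orthogonal with respect to `S`. -/
theorem card_pairs_eq [Finite F] (S : Matrix (Fin 3) (Fin 3) F) :
    (Nat.card {p : (Fin 3 → F) × (Fin 3 → F) // p.2 ⬝ᵥ S *ᵥ p.1 = 0} : ℚ) =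
      (Nat.card F : ℚ) ^ 5 + kerCard S * ((Nat.card F : ℚ) ^ 3 - (Nat.card F : ℚ) ^ 2) := by
  classical
  have := Fintype.ofFinite F
  have h1 : Nat.card {p : (Fin 3 → F) × (Fin 3 → F) // p.2 ⬝ᵥ S *ᵥ p.1 = 0} =
      ∑ v : Fin 3 → F, Nat.card {w : Fin 3 → F // w ⬝ᵥ S *ᵥ v = 0} := by
    rw [Nat.card_congr (Equiv.subtypeProdEquivSigmaSubtype
      fun (v w : Fin 3 → F) => w ⬝ᵥ S *ᵥ v = 0), Nat.card_sigma]
  -- A vector of the kernel is orthogonal to all q³ vectors, any other vector to q² of them.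
  have h3 : ∀ v : Fin 3 → F, (Nat.card {w : Fin 3 → F // w ⬝ᵥ S *ᵥ v = 0} : ℚ) =
      (Nat.card F : ℚ) ^ 2 + if S *ᵥ v = 0 then
        ((Nat.card F : ℚ) ^ 3 - (Nat.card F : ℚ) ^ 2) else 0 := by
    intro v
    split_ifs with hv
    · simp [hv]
    · rw [card_dotProduct_eq_zero hv]
      simp
  rw [h1, Nat.cast_sum, Finset.sum_congr rfl fun b _ => h3 b, Finset.sum_add_distrib,
    ← Finset.sum_filter, Finset.sum_const, Finset.sum_const, nsmul_eq_mul, nsmul_eq_mul, kerCard,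
    Nat.card_eq_fintype_card (α := {b // _}), Fintype.card_subtype]
  simp
  ring

/-- The number of coefficient vectors of type `t` orthogonal to `y`. -/
noncomputable def typeCard (ε : F) (t : Fin 4) (y : Fin 6 → F) : ℕ :=
  Nat.card {a : Fin 6 → F // HasType ε t (dualMat a) ∧ a ⬝ᵥ y = 0}

/-- The types partition the nonzero coefficient vectors, so a function of the type is summed type by
type; a = 0 has no type and contributes separately. -/
theorem sum_orthogonal_eq_sum_types [Fintype F] [DecidableEq F] (h2 : (2 : F) ≠ 0) {ε : F}
    (hε : ¬IsSquare ε) (y : Fin 6 → F) (G : (Fin 6 → F) → ℚ) (g : Fin 4 → ℚ)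
    (hg : ∀ a t, HasType ε t (dualMat a) → G a = g t) :
    ∑ a : Fin 6 → F with a ⬝ᵥ y = 0, G a = G 0 + ∑ t, (typeCard ε t y : ℚ) * g t := by
  classical
  have key : ∀ a, G a = (if a = 0 then G 0 else 0) +
      ∑ t, if HasType ε t (dualMat a) then g t else 0 := by
    intro a
    by_cases ha : a = 0
    · subst ha
      rw [if_pos rfl, Finset.sum_eq_zero, add_zero]
      intro t _
      exact if_neg fun h => h.ne_zero h2 dualMat_zero
    · obtain ⟨t, ht⟩ := exists_hasType h2 hε (isSymm_dualMat a) fun h =>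
        ha (dualMat_injective h2 (h.trans dualMat_zero.symm))
      rw [if_neg ha, zero_add, Finset.sum_eq_single t, if_pos ht, hg a t ht]
      · intro s _ hst
        exact if_neg fun h => hst (h.unique h2 hε ht)
      · simp
  rw [Finset.sum_congr rfl fun a _ => key a, Finset.sum_add_distrib, Finset.sum_comm]
  congr 1
  · simp
  · refine Finset.sum_congr rfl fun t _ => ?_
    rw [← Finset.sum_filter, Finset.sum_const, nsmul_eq_mul, Finset.filter_filter, typeCard,
      Nat.card_eq_fintype_card, Fintype.card_subtype]
    simp only [and_comm]

/-! ### Multiples of a symmetric matrix of the form `v vᵀ` or `v wᵀ + w vᵀ` -/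

/-- The number of vectors `v` such that `v vᵀ` is a multiple of `M`. -/
noncomputable def sqCard (M : Matrix (Fin 3) (Fin 3) F) : ℕ :=
  Nat.card {v : Fin 3 → F // ∃ c : F, Matrix.vecMulVec v v = c • M}

/-- The number of pairs `(v, w)` such that `v wᵀ + w vᵀ` is a multiple of `M`. -/
noncomputable def prodCard (M : Matrix (Fin 3) (Fin 3) F) : ℕ :=
  Nat.card {p : (Fin 3 → F) × (Fin 3 → F) //
    ∃ c : F, Matrix.vecMulVec p.1 p.2 + Matrix.vecMulVec p.2 p.1 = c • M}

theorem mul_vecMulVec_mul_transpose (A : Matrix (Fin 3) (Fin 3) F) (v w : Fin 3 → F) :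
    A * Matrix.vecMulVec v w * Aᵀ = Matrix.vecMulVec (A *ᵥ v) (A *ᵥ w) := by
  rw [Matrix.mul_vecMulVec, Matrix.vecMulVec_mul, Matrix.vecMul_transpose]

theorem congr_injective {A : Matrix (Fin 3) (Fin 3) F} (hA : A.det ≠ 0) :
    Function.Injective fun M : Matrix (Fin 3) (Fin 3) F => A * M * Aᵀ := by
  intro M N h
  have hu : IsUnit A := (Matrix.isUnit_iff_isUnit_det A).2 (isUnit_iff_ne_zero.2 hA)
  have hu' : IsUnit Aᵀ := (Matrix.isUnit_transpose A).2 hu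
  exact hu.mul_left_cancel (hu'.mul_right_cancel h)

theorem Sim.prodCard_eq {M N : Matrix (Fin 3) (Fin 3) F} (h : Sim M N) :
    prodCard N = prodCard M := by
  obtain ⟨A, c, hA, hc, rfl⟩ := h
  refine (Nat.card_congr
    (((mulVecEquiv A hA).prodCongr (mulVecEquiv A hA)).subtypeEquiv fun v => ?_)).symm
  change _ ↔ ∃ d : F, Matrix.vecMulVec (A *ᵥ v.1) (A *ᵥ v.2) +
    Matrix.vecMulVec (A *ᵥ v.2) (A *ᵥ v.1) = _
  rw [← mul_vecMulVec_mul_transpose, ← mul_vecMulVec_mul_transpose, ← Matrix.add_mul,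
    ← Matrix.mul_add]
  constructor
  · rintro ⟨d, hd⟩
    refine ⟨d / c, ?_⟩
    rw [hd, smul_smul, div_mul_cancel₀ _ hc, Matrix.mul_smul, Matrix.smul_mul]
  · rintro ⟨d, hd⟩
    refine ⟨d * c, congr_injective hA ?_⟩
    simpa only [Matrix.mul_smul, Matrix.smul_mul, smul_smul] using hd

/-- Independent factors give type 1 by definition; if w = sv, the symmetrized product is 2s times
the square of v. -/
theorem hasType_one_or_zero_of_ne_zero (h2 : (2 : F) ≠ 0) (ε : F) {v w : Fin 3 → F} (hv : v ≠ 0)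
    (hw : w ≠ 0) : HasType ε 1 (Matrix.vecMulVec v w + Matrix.vecMulVec w v) ∨
      HasType ε 0 (Matrix.vecMulVec v w + Matrix.vecMulVec w v) := by
  by_cases h : LinearIndependent F ![v, w]
  · exact Or.inl (hasType_one_iff.2 ⟨v, w, h, rfl⟩)
  · right
    rw [LinearIndependent.pair_iff' hv] at h
    push Not at h
    obtain ⟨s, rfl⟩ := h
    have hs : s ≠ 0 := by
      rintro rfl
      simp at hw
    refine hasType_zero_iff.2 ⟨2 * s, v, mul_ne_zero h2 hs, hv, ?_⟩
    rw [Matrix.vecMulVec_smul, Matrix.smul_vecMulVec, ← two_smul F, smul_smul]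

theorem HasType.smul {ε : F} {S : Matrix (Fin 3) (Fin 3) F} {t : Fin 4} (h : HasType ε t S)
    {c : F} (hc : c ≠ 0) : HasType ε t (c • S) :=
  Sim.trans h (Sim.smul _ hc)

theorem HasType.of_smul {ε : F} {S : Matrix (Fin 3) (Fin 3) F} {t : Fin 4} {c : F}
    (h : HasType ε t (c • S)) (hc : c ≠ 0) : HasType ε t S := by
  simpa [smul_smul, inv_mul_cancel₀ hc] using h.smul (inv_ne_zero hc)

theorem vecMulVec_self_ne_zero {v : Fin 3 → F} (hv : v ≠ 0) : Matrix.vecMulVec v v ≠ 0 := by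
  obtain ⟨i, hi⟩ := Function.ne_iff.1 hv
  intro h
  simpa [Matrix.vecMulVec_apply] using And.intro hi (congrFun (congrFun h i) i)

/-- Vectors with proportional squares are proportional. -/
theorem eq_smul_of_vecMulVec_self {v w : Fin 3 → F} {c : F} (hv : v ≠ 0)
    (h : Matrix.vecMulVec v v = c • Matrix.vecMulVec w w) : ∃ s : F, s ≠ 0 ∧ v = s • w := by
  obtain ⟨i, hi⟩ := Function.ne_iff.1 hv
  have hj : ∀ j, v j * v i = c * (w j * w i) := fun j => by
    simpa [Matrix.vecMulVec_apply] using congrFun (congrFun h j) i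
  have hv' : v = (c * w i / v i) • w := by
    funext j
    have := hj j
    simp only [Pi.zero_apply, ne_eq] at hi
    simp only [Pi.smul_apply, smul_eq_mul]
    field_simp
    linear_combination this
  refine ⟨_, ?_, hv'⟩
  intro h0
  rw [h0, zero_smul] at hv'
  exact hv hv'

/-- A nonzero square has type 0, so only v = 0 (with multiplier 0) is counted. -/
theorem sqCard_eq_one [Finite F] (h2 : (2 : F) ≠ 0) {ε : F} (hε : ¬IsSquare ε)
    {M : Matrix (Fin 3) (Fin 3) F} {t : Fin 4} (h : HasType ε t M) (ht : t ≠ 0) :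
    sqCard M = 1 := by
  rw [sqCard, ← Nat.card_unique (α := Unit)]
  refine card_subtype_of_param (fun _ => 0) (fun _ _ _ => rfl) fun v => ?_
  constructor
  · rintro ⟨c, hc⟩
    refine ⟨(), ?_⟩
    by_contra hv
    have hc0 : c ≠ 0 := by
      rintro rfl
      exact vecMulVec_self_ne_zero (Ne.symm hv) (by rw [hc, zero_smul])
    have h0 : HasType ε 0 (c • M) :=
      hasType_zero_iff.2 ⟨1, v, one_ne_zero, Ne.symm hv, by rw [one_smul, hc]⟩
    exact ht (h.unique h2 hε (h0.of_smul hc0))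
  · rintro ⟨-, rfl⟩
    exact ⟨0, by simp⟩

theorem HasType.sqCard_eq_zero [Finite F] {ε : F} {M : Matrix (Fin 3) (Fin 3) F}
    (h : HasType ε 0 M) : sqCard M = Nat.card F := by
  obtain ⟨c, v, hc, hv, rfl⟩ := hasType_zero_iff.1 h
  refine card_subtype_of_param (fun s : F => s • v) (smul_left_injective F hv) fun w => ?_
  constructor
  · rintro ⟨d, hd⟩
    rw [smul_smul] at hd
    by_cases hw : w = 0
    · exact ⟨0, by simp [hw]⟩
    · obtain ⟨s, -, hs⟩ := eq_smul_of_vecMulVec_self hw hd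
      exact ⟨s, hs.symm⟩
  · rintro ⟨s, rfl⟩
    refine ⟨s * s / c, ?_⟩
    rw [smul_smul, div_mul_cancel₀ _ hc, Matrix.smul_vecMulVec, Matrix.vecMulVec_smul, smul_smul]

/-- A parametrization of the pairs of vectors with a vanishing entry. -/
def zeroPair : (Fin 3 → F) ⊕ {v : Fin 3 → F // v ≠ 0} → (Fin 3 → F) × (Fin 3 → F) :=
  Sum.elim (fun w => (0, w)) (fun v => (v, 0))

theorem zeroPair_injective : Function.Injective (zeroPair : _ → (Fin 3 → F) × (Fin 3 → F)) := by
  rintro (a | a) (b | b) h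
  · simpa [zeroPair] using h
  · simp only [zeroPair, Sum.elim_inl, Sum.elim_inr, Prod.mk.injEq] at h
    exact absurd h.1.symm b.2
  · simp only [zeroPair, Sum.elim_inl, Sum.elim_inr, Prod.mk.injEq] at h
    exact absurd h.1 a.2
  · simpa [zeroPair, Subtype.ext_iff] using h

theorem exists_zeroPair_eq_iff (p : (Fin 3 → F) × (Fin 3 → F)) :
    (∃ a, zeroPair a = p) ↔ p.1 = 0 ∨ p.2 = 0 := by
  constructor
  · rintro ⟨a | a, rfl⟩ <;> simp [zeroPair]
  · intro h
    by_cases h1 : p.1 = 0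
    · exact ⟨Sum.inl p.2, by ext <;> simp [zeroPair, h1]⟩
    · exact ⟨Sum.inr ⟨p.1, h1⟩, by ext <;> simp [zeroPair, h.resolve_left h1]⟩

theorem card_zeroPair_domain [Finite F] :
    (Nat.card ((Fin 3 → F) ⊕ {v : Fin 3 → F // v ≠ 0}) : ℚ) = 2 * (Nat.card F : ℚ) ^ 3 - 1 := by
  classical
  have := Fintype.ofFinite F
  have h : 1 ≤ Fintype.card F ^ 3 := Nat.one_le_pow _ _ Fintype.card_pos
  rw [Nat.card_eq_fintype_card, Fintype.card_sum, Fintype.card_subtype_compl]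
  simp [h]
  ring

/-- Products of nonzero vectors have type 0 or 1, so only the 2q³ − 1 pairs with a zero entry
remain, with multiplier 0. -/
theorem prodCard_of_two_le [Finite F] (h2 : (2 : F) ≠ 0) {ε : F} (hε : ¬IsSquare ε)
    {M : Matrix (Fin 3) (Fin 3) F} {t : Fin 4} (h : HasType ε t M) (h0 : t ≠ 0) (h1 : t ≠ 1) :
    (prodCard M : ℚ) = 2 * (Nat.card F : ℚ) ^ 3 - 1 := by
  rw [← card_zeroPair_domain, prodCard]
  congr 1
  refine card_subtype_of_param zeroPair zeroPair_injective fun p => ?_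
  rw [exists_zeroPair_eq_iff]
  constructor
  · rintro ⟨c, hc⟩
    by_contra! hp
    have key := hasType_one_or_zero_of_ne_zero h2 ε hp.1 hp.2
    rw [hc] at key
    have hc0 : c ≠ 0 := by
      rintro rfl
      rcases key with key | key <;> exact key.ne_zero h2 (zero_smul _ _)
    rcases key with key | key
    · exact h1 (h.unique h2 hε (key.of_smul hc0))
    · exact h0 (h.unique h2 hε (key.of_smul hc0))
  · rintro (hp | hp) <;> exact ⟨0, by simp [hp]⟩

/-- Besides the pairs with a zero entry there are those whose two entries are nonzero multiples of
the vector u that spans the rank-one matrix: (q − 1)² pairs. -/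
theorem HasType.prodCard_eq_zero [Finite F] (h2 : (2 : F) ≠ 0) {ε : F} (hε : ¬IsSquare ε)
    {M : Matrix (Fin 3) (Fin 3) F} (h : HasType ε 0 M) :
    (prodCard M : ℚ) = 2 * (Nat.card F : ℚ) ^ 3 - 1 + ((Nat.card F : ℚ) - 1) ^ 2 := by
  have e : (((Nat.card F - 1) * (Nat.card F - 1) : ℕ) : ℚ) = ((Nat.card F : ℚ) - 1) ^ 2 := by
    rw [Nat.cast_mul, Nat.cast_sub Nat.card_pos, pow_two]
    simp
  rw [← card_zeroPair_domain, ← e, ← Nat.card_units, ← Nat.card_prod, ← Nat.cast_add,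
    ← Nat.card_sum]
  congr 1
  obtain ⟨c, u, hc, hu, rfl⟩ := hasType_zero_iff.1 h
  refine card_subtype_of_param
    (Sum.elim zeroPair fun s : Fˣ × Fˣ => ((s.1 : F) • u, (s.2 : F) • u)) ?_ fun p => ?_
  · refine zeroPair_injective.sumElim ?_ ?_
    · rintro ⟨a, b⟩ ⟨c, d⟩ h
      simp only [Prod.mk.injEq] at h
      exact Prod.ext (Units.ext (smul_left_injective F hu h.1))
        (Units.ext (smul_left_injective F hu h.2))
    · rintro a ⟨b, c⟩ h
      have := (exists_zeroPair_eq_iff _).1 ⟨a, h⟩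
      simp [hu] at this
  · rw [Sum.exists]
    simp only [Sum.elim_inl, Sum.elim_inr, exists_zeroPair_eq_iff]
    constructor
    · rintro ⟨d, hd⟩
      by_cases hp : p.1 = 0 ∨ p.2 = 0
      · exact Or.inl hp
      · right
        rw [not_or] at hp
        rw [smul_smul] at hd
        have hdc : d * c ≠ 0 := by
          intro h0
          rw [h0, zero_smul] at hd
          rcases hasType_one_or_zero_of_ne_zero h2 ε hp.1 hp.2 with key | key <;>
            exact key.ne_zero h2 hd
        by_cases hli : LinearIndependent F ![p.1, p.2]
        · have t0 : HasType ε 0 (Matrix.vecMulVec p.1 p.2 + Matrix.vecMulVec p.2 p.1) :=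
            hasType_zero_iff.2 ⟨_, u, hdc, hu, hd⟩
          have t1 : HasType ε 1 (Matrix.vecMulVec p.1 p.2 + Matrix.vecMulVec p.2 p.1) :=
            hasType_one_iff.2 ⟨_, _, hli, rfl⟩
          exact absurd (t0.unique h2 hε t1) (by decide)
        · rw [LinearIndependent.pair_iff' hp.1] at hli
          push Not at hli
          obtain ⟨s, hs⟩ := hli
          have hs0 : s ≠ 0 := by
            rintro rfl
            exact hp.2 (by rw [← hs, zero_smul])
          -- With `p.2 = s • p.1` the product is 2s times a square, and proportional squares have
          -- proportional roots.
          have h3 : Matrix.vecMulVec p.1 p.1 =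
              (d * c / (2 * s)) • Matrix.vecMulVec u u := by
            have h4 : (2 * s) • Matrix.vecMulVec p.1 p.1 = (d * c) • Matrix.vecMulVec u u := by
              rw [← hd, ← hs, Matrix.vecMulVec_smul, Matrix.smul_vecMulVec]
              module
            rw [div_eq_inv_mul, mul_smul, ← h4, inv_smul_smul₀ (mul_ne_zero h2 hs0)]
          obtain ⟨r, hr, hr'⟩ := eq_smul_of_vecMulVec_self hp.1 h3
          refine ⟨(Units.mk0 r hr, Units.mk0 (s * r) (mul_ne_zero hs0 hr)), ?_⟩
          ext1
          · exact hr'.symm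
          · change (s * r) • u = p.2
            rw [← hs, hr', smul_smul]
    · rintro (hp | ⟨⟨a, b⟩, rfl⟩)
      · exact ⟨0, by rcases hp with hp | hp <;> simp [hp]⟩
      · refine ⟨2 * a * b / c, ?_⟩
        simp only [Matrix.smul_vecMulVec, Matrix.vecMulVec_smul, smul_smul]
        rw [div_mul_cancel₀ _ hc]
        module

/-- Unique factorization of a multiple of X₀X₁, done by comparing entries: up to scalars and order
the factors are X₀ and X₁. -/
theorem cases_of_symm_product_eq (h2 : (2 : F) ≠ 0) {v w : Fin 3 → F} {c ε : F} (hv : v ≠ 0)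
    (hw : w ≠ 0) (h : Matrix.vecMulVec v w + Matrix.vecMulVec w v = c • typeRep ε 1) :
    (∃ a b : F, a ≠ 0 ∧ b ≠ 0 ∧ v = ![a, 0, 0] ∧ w = ![0, b, 0]) ∨
      ∃ a b : F, a ≠ 0 ∧ b ≠ 0 ∧ v = ![0, a, 0] ∧ w = ![b, 0, 0] := by
  have e : ∀ i j, v i * w j + w i * v j = c * typeRep ε 1 i j := fun i j => by
    simpa [Matrix.vecMulVec_apply] using congrFun (congrFun h i) j
  have ext3 : ∀ {x : Fin 3 → F} {a b d : F}, x 0 = a → x 1 = b → x 2 = d → x = ![a, b, d] := by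
    rintro x a b d rfl rfl rfl
    funext i
    fin_cases i <;> rfl
  have ne3 : ∀ {x : Fin 3 → F}, x ≠ 0 → x 0 = 0 → x 1 = 0 → x 2 = 0 → False := by
    intro x hx h0 h1 h3
    apply hx
    funext i
    fin_cases i <;> assumption
  have e00 : v 0 * w 0 = 0 := by
    have : 2 * (v 0 * w 0) = 0 := by
      have := e 0 0
      simp [typeRep] at this
      linear_combination this
    exact (mul_eq_zero.1 this).resolve_left h2
  have e11 : v 1 * w 1 = 0 := by
    have : 2 * (v 1 * w 1) = 0 := by
      have := e 1 1
      simp [typeRep] at this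
      linear_combination this
    exact (mul_eq_zero.1 this).resolve_left h2
  have e22 : v 2 * w 2 = 0 := by
    have : 2 * (v 2 * w 2) = 0 := by
      have := e 2 2
      simp [typeRep] at this
      linear_combination this
    exact (mul_eq_zero.1 this).resolve_left h2
  have e02 : v 0 * w 2 + w 0 * v 2 = 0 := by simpa [typeRep] using e 0 2
  have e12 : v 1 * w 2 + w 1 * v 2 = 0 := by simpa [typeRep] using e 1 2
  by_cases hv0 : v 0 = 0
  · right
    by_cases hw0 : w 0 = 0
    · exfalso
      by_cases hv1 : v 1 = 0
      · have hv2 : v 2 ≠ 0 := ne3 hv hv0 hv1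
        have hw2 := (mul_eq_zero.1 e22).resolve_left hv2
        rw [hw2, mul_zero, zero_add] at e12
        exact ne3 hw hw0 ((mul_eq_zero.1 e12).resolve_right hv2) hw2
      · have hw1 := (mul_eq_zero.1 e11).resolve_left hv1
        rw [hw1, zero_mul, add_zero] at e12
        exact ne3 hw hw0 hw1 ((mul_eq_zero.1 e12).resolve_left hv1)
    · rw [hv0, zero_mul, zero_add] at e02
      have hv2 := (mul_eq_zero.1 e02).resolve_left hw0
      have hv1 : v 1 ≠ 0 := fun h => ne3 hv hv0 h hv2
      have hw1 := (mul_eq_zero.1 e11).resolve_left hv1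
      rw [hw1, zero_mul, add_zero] at e12
      exact ⟨v 1, w 0, hv1, hw0, ext3 hv0 rfl hv2,
        ext3 rfl hw1 ((mul_eq_zero.1 e12).resolve_left hv1)⟩
  · left
    have hw0 := (mul_eq_zero.1 e00).resolve_left hv0
    rw [hw0, zero_mul, add_zero] at e02
    have hw2 := (mul_eq_zero.1 e02).resolve_left hv0
    have hw1 : w 1 ≠ 0 := fun h => ne3 hw hw0 h hw2
    have hv1 := (mul_eq_zero.1 e11).resolve_right hw1
    rw [hw2, mul_zero, zero_add] at e12
    exact ⟨v 0, w 1, hv0, hw1, ext3 rfl hv1 ((mul_eq_zero.1 e12).resolve_left hw1),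
      ext3 hw0 rfl hw2⟩

/-- For the representative, the two orders of the factors each contribute (q − 1)² pairs of nonzero
vectors. -/
theorem HasType.prodCard_eq_one [Finite F] (h2 : (2 : F) ≠ 0) {ε : F}
    {M : Matrix (Fin 3) (Fin 3) F} (h : HasType ε 1 M) :
    (prodCard M : ℚ) = 2 * (Nat.card F : ℚ) ^ 3 - 1 + 2 * ((Nat.card F : ℚ) - 1) ^ 2 := by
  have e : ((((Nat.card F - 1) * (Nat.card F - 1)) + ((Nat.card F - 1) * (Nat.card F - 1)) : ℕ) :
      ℚ) = 2 * ((Nat.card F : ℚ) - 1) ^ 2 := by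
    rw [Nat.cast_add, Nat.cast_mul, Nat.cast_sub Nat.card_pos, pow_two]
    simp
    ring
  rw [Sim.prodCard_eq h, ← card_zeroPair_domain, ← e, ← Nat.card_units, ← Nat.card_prod,
    ← Nat.card_sum, ← Nat.cast_add, ← Nat.card_sum]
  congr 1
  refine card_subtype_of_param
    (Sum.elim zeroPair (Sum.elim (fun s : Fˣ × Fˣ => (![(s.1 : F), 0, 0], ![0, (s.2 : F), 0]))
      fun s : Fˣ × Fˣ => (![0, (s.1 : F), 0], ![(s.2 : F), 0, 0]))) ?_ fun p => ?_
  · refine zeroPair_injective.sumElim (Function.Injective.sumElim ?_ ?_ ?_) ?_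
    · rintro ⟨a, b⟩ ⟨c, d⟩ h
      simpa [Units.ext_iff] using h
    · rintro ⟨a, b⟩ ⟨c, d⟩ h
      simpa [Units.ext_iff] using h
    · rintro ⟨a, b⟩ ⟨c, d⟩ h
      simp at h
    · rintro a (⟨b, c⟩ | ⟨b, c⟩) h
      all_goals
        have := (exists_zeroPair_eq_iff _).1 ⟨a, h⟩
        simp at this
  · rw [Sum.exists]
    simp only [Sum.elim_inl, Sum.elim_inr, exists_zeroPair_eq_iff]
    rw [Sum.exists]
    simp only [Sum.elim_inl, Sum.elim_inr]
    constructor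
    · rintro ⟨d, hd⟩
      by_cases hp : p.1 = 0 ∨ p.2 = 0
      · exact Or.inl hp
      · right
        rw [not_or] at hp
        rcases cases_of_symm_product_eq h2 hp.1 hp.2 hd with
          ⟨a, b, ha, hb, h1, h3⟩ | ⟨a, b, ha, hb, h1, h3⟩
        · exact Or.inl ⟨(Units.mk0 a ha, Units.mk0 b hb), Prod.ext h1.symm h3.symm⟩
        · exact Or.inr ⟨(Units.mk0 a ha, Units.mk0 b hb), Prod.ext h1.symm h3.symm⟩
    · rintro (hp | ⟨⟨a, b⟩, rfl⟩ | ⟨⟨a, b⟩, rfl⟩)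
      · exact ⟨0, by rcases hp with hp | hp <;> simp [hp]⟩
      all_goals
        refine ⟨(a : F) * b, ?_⟩
        ext i j
        fin_cases i <;> fin_cases j <;> simp [typeRep, mul_comm]

/-! ### The numbers of vectors of each type orthogonal to a vector -/

theorem dualMat_prodVec_self (v : Fin 3 → F) :
    dualMat (prodVec v v) = (2 : F) • Matrix.vecMulVec v v := by
  rw [dualMat_prodVec, two_smul]

theorem prodVec_self_ne_zero (h2 : (2 : F) ≠ 0) {v : Fin 3 → F} (hv : v ≠ 0) :
    prodVec v v ≠ 0 := by
  intro h
  have := dualMat_prodVec_self v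
  rw [h, dualMat_zero] at this
  exact vecMulVec_self_ne_zero hv ((smul_eq_zero.1 this.symm).resolve_left h2)

theorem prodVec_smul (s : F) (v : Fin 3 → F) :
    prodVec (s • v) (s • v) = (s * s) • prodVec v v := by
  funext i
  fin_cases i <;> simp [prodVec] <;> ring

theorem hasType_zero_dualMat_iff (h2 : (2 : F) ≠ 0) {ε : F} {a : Fin 6 → F} :
    HasType ε 0 (dualMat a) ↔ ∃ (c : F) (v : Fin 3 → F), c ≠ 0 ∧ v ≠ 0 ∧
      a = c • prodVec v v := by
  rw [hasType_zero_iff]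
  constructor
  · rintro ⟨c, v, hc, hv, h⟩
    refine ⟨c / 2, v, div_ne_zero hc h2, hv, dualMat_injective h2 ?_⟩
    rw [dualMat_smul, dualMat_prodVec_self, smul_smul, div_mul_cancel₀ _ h2, h]
  · rintro ⟨c, v, hc, hv, rfl⟩
    refine ⟨c * 2, v, mul_ne_zero hc h2, hv, ?_⟩
    rw [dualMat_smul, dualMat_prodVec_self, smul_smul]

theorem eq_smul_of_prodVec_self (h2 : (2 : F) ≠ 0) {v w : Fin 3 → F} {c d : F} (hc : c ≠ 0)
    (hv : v ≠ 0) (h : c • prodVec v v = d • prodVec w w) : ∃ s : F, s ≠ 0 ∧ v = s • w := by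
  refine eq_smul_of_vecMulVec_self (c := d / c) hv ?_
  have h' := congrArg dualMat h
  rw [dualMat_smul, dualMat_smul, dualMat_prodVec_self, dualMat_prodVec_self, smul_comm c,
    smul_comm d] at h'
  have h3 := smul_right_injective _ h2 h'
  rw [div_eq_inv_mul, mul_smul, ← h3, inv_smul_smul₀ hc]

/-- There are as many double lines orthogonal to `y` as isotropic points. -/
theorem typeCard_zero [Finite F] (h2 : (2 : F) ≠ 0) (ε : F) (y : Fin 6 → F) :
    (typeCard ε 0 y : ℚ) = isoCard (symMat y) - 1 := by
  classical
  have := Fintype.ofFinite F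
  have hq : 0 < Nat.card Fˣ := Nat.card_pos
  have hiso : isoCard (symMat y) =
      Nat.card {v : Fin 3 → F // v ≠ 0 ∧ v ⬝ᵥ symMat y *ᵥ v = 0} + 1 := by
    rw [isoCard, Nat.card_eq_fintype_card, Nat.card_eq_fintype_card, Fintype.card_subtype,
      Fintype.card_subtype, ← Finset.filter_filter, Finset.filter_comm, Finset.filter_ne',
      Finset.card_erase_add_one]
    simp
  have key : typeCard ε 0 y =
      Nat.card {v : Fin 3 → F // v ≠ 0 ∧ v ⬝ᵥ symMat y *ᵥ v = 0} := by
    -- Double count the relation "a is a nonzero multiple of the square of v": each `a` has q − 1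
    -- such roots v, and each v has q − 1 such multiples a.
    refine Nat.eq_of_mul_eq_mul_right hq ?_
    rw [typeCard, Nat.card_eq_fintype_card (α := {a // _}),
      Nat.card_eq_fintype_card (α := {v // _}), Fintype.card_subtype, Fintype.card_subtype]
    refine Finset.card_mul_eq_card_mul
      (fun (a : Fin 6 → F) (v : Fin 3 → F) => ∃ c : F, c ≠ 0 ∧ a = c • prodVec v v) ?_ ?_
    · intro a ha
      simp only [Finset.mem_filter, Finset.mem_univ, true_and] at ha
      obtain ⟨⟨c, u, hc, hu, rfl⟩, hy⟩ :=
        And.imp_left (hasType_zero_dualMat_iff h2).1 ha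
      rw [smul_dotProduct, smul_eq_zero_iff_right hc, prodVec_dotProduct] at hy
      rw [Finset.bipartiteAbove, Finset.filter_filter, ← Fintype.card_subtype,
        ← Nat.card_eq_fintype_card]
      refine card_subtype_of_param (fun s : Fˣ => (s : F) • u)
        (fun s t h => Units.ext (smul_left_injective F hu h)) fun v => ?_
      constructor
      · rintro ⟨⟨hv, -⟩, d, hd, h⟩
        obtain ⟨s, hs, rfl⟩ := eq_smul_of_prodVec_self h2 hd hv h.symm
        exact ⟨Units.mk0 s hs, rfl⟩
      · rintro ⟨s, rfl⟩
        refine ⟨⟨smul_ne_zero s.ne_zero hu, ?_⟩, c / (s * s), ?_, ?_⟩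
        · rw [Matrix.mulVec_smul, smul_dotProduct, dotProduct_smul, hy, smul_zero, smul_zero]
        · exact div_ne_zero hc (mul_ne_zero s.ne_zero s.ne_zero)
        · rw [prodVec_smul, smul_smul, div_mul_cancel₀ _ (mul_ne_zero s.ne_zero s.ne_zero)]
    · intro v hv
      simp only [Finset.mem_filter, Finset.mem_univ, true_and] at hv
      rw [Finset.bipartiteBelow, Finset.filter_filter, ← Fintype.card_subtype,
        ← Nat.card_eq_fintype_card]
      refine card_subtype_of_param (fun s : Fˣ => (s : F) • prodVec v v)
        (fun s t h => Units.ext (smul_left_injective F (prodVec_self_ne_zero h2 hv.1) h))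
        fun a => ?_
      constructor
      · rintro ⟨-, c, hc, rfl⟩
        exact ⟨Units.mk0 c hc, rfl⟩
      · rintro ⟨s, rfl⟩
        refine ⟨⟨(hasType_zero_dualMat_iff h2).2 ⟨s, v, s.ne_zero, hv.1, rfl⟩, ?_⟩,
          s, s.ne_zero, rfl⟩
        rw [smul_dotProduct, prodVec_dotProduct, hv.2, smul_zero]
  rw [key, hiso]
  push_cast
  ring

/-- First equation of the linear system, from the constant weight 1; the summand 1 is a = 0. -/
theorem typeCard_sum [Finite F] (h2 : (2 : F) ≠ 0) {ε : F} (hε : ¬IsSquare ε) {y : Fin 6 → F}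
    (hy : y ≠ 0) : 1 + ∑ t, (typeCard ε t y : ℚ) = (Nat.card F : ℚ) ^ 5 := by
  classical
  have := Fintype.ofFinite F
  have h := sum_orthogonal_eq_sum_types h2 hε y (fun _ => 1) (fun _ => 1) fun _ _ _ => rfl
  simp only [mul_one] at h
  rw [← h, ← Nat.cast_pow, ← card_dotProduct_eq_zero hy, Finset.sum_const, nsmul_one,
    Nat.card_eq_fintype_card, Fintype.card_subtype]

/-- The number of isotropic vectors of a matrix of a given type. -/
def isoValue (q : ℚ) : Fin 4 → ℚ := ![q ^ 2, 2 * q ^ 2 - q, q, q ^ 2]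

/-- The size of the kernel of a matrix of a given type. -/
def kerValue (q : ℚ) : Fin 4 → ℚ := ![q ^ 2, q, q, 1]

theorem HasType.isoCard_eq [Finite F] (h2 : (2 : F) ≠ 0) {ε : F} (hε : ¬IsSquare ε)
    {M : Matrix (Fin 3) (Fin 3) F} {t : Fin 4} (h : HasType ε t M) :
    (isoCard M : ℚ) = isoValue (Nat.card F) t := by
  fin_cases t
  · rw [h.isoCard_eq_zero]
    simp [isoValue]
  · rw [h.isoCard_eq_one h2]
    rw [Nat.cast_add, Nat.cast_mul, Nat.cast_sub Nat.card_pos]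
    simp [isoValue]
    ring
  · rw [h.isoCard_eq_two hε]
    simp [isoValue]
  · rw [h.isoCard_eq_three h2]
    simp [isoValue]

theorem HasType.kerCard_eq [Finite F] (h2 : (2 : F) ≠ 0) {ε : F} (hε : ¬IsSquare ε)
    {M : Matrix (Fin 3) (Fin 3) F} {t : Fin 4} (h : HasType ε t M) :
    (kerCard M : ℚ) = kerValue (Nat.card F) t := by
  fin_cases t
  · rw [h.kerCard_eq_zero]
    simp [kerValue]
  · rw [h.kerCard_eq_one]
    simp [kerValue]
  · rw [h.kerCard_eq_two hε]
    simp [kerValue]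
  · rw [h.kerCard_eq_three h2]
    simp [kerValue]

theorem mem_span_iff_symMat (b y : Fin 6 → F) :
    b ∈ Submodule.span F {y} ↔ ∃ c : F, symMat b = c • symMat y := by
  rw [Submodule.mem_span_singleton]
  refine exists_congr fun c => ?_
  rw [← symMat_smul, symMat_injective.eq_iff, eq_comm]

/-- Second equation: count the pairs (a, v) with a ⊥ y and v isotropic for a. It tells type 1 from
type 2. -/
theorem typeCard_sum_isoValue [Finite F] (h2 : (2 : F) ≠ 0) {ε : F} (hε : ¬IsSquare ε)
    {y : Fin 6 → F} (hy : y ≠ 0) :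
    (Nat.card F : ℚ) ^ 3 + ∑ t, (typeCard ε t y : ℚ) * isoValue (Nat.card F) t =
      (Nat.card F : ℚ) ^ 7 +
        sqCard (symMat y) * ((Nat.card F : ℚ) ^ 5 - (Nat.card F : ℚ) ^ 4) := by
  classical
  have := Fintype.ofFinite F
  have h := sum_orthogonal_eq_sum_types h2 hε y (fun a => (isoCard (dualMat a) : ℚ))
    (isoValue (Nat.card F)) fun a t ht => ht.isoCard_eq h2 hε
  have e : (isoCard (dualMat (0 : Fin 6 → F)) : ℚ) = (Nat.card F : ℚ) ^ 3 := by
    simp [isoCard, dualMat_zero]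
  rw [e] at h
  rw [← h]
  simp only [isoCard_dualMat h2]
  rw [sum_card_orthogonal hy, sqCard]
  simp only [mem_span_iff_symMat, symMat_veroneseVec]
  simp
  ring

/-- Third equation: count the triples (a, v, w) with a ⊥ y and v, w orthogonal for a. The weight of
a depends only on the size of its kernel, hence on its rank. -/
theorem typeCard_sum_kerValue [Finite F] (h2 : (2 : F) ≠ 0) {ε : F} (hε : ¬IsSquare ε)
    {y : Fin 6 → F} (hy : y ≠ 0) :
    (Nat.card F : ℚ) ^ 6 + ∑ t, (typeCard ε t y : ℚ) * ((Nat.card F : ℚ) ^ 5 +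
        kerValue (Nat.card F) t * ((Nat.card F : ℚ) ^ 3 - (Nat.card F : ℚ) ^ 2)) =
      (Nat.card F : ℚ) ^ 10 +
        prodCard (symMat y) * ((Nat.card F : ℚ) ^ 5 - (Nat.card F : ℚ) ^ 4) := by
  classical
  have := Fintype.ofFinite F
  have h := sum_orthogonal_eq_sum_types h2 hε y
    (fun a => (Nat.card {p : (Fin 3 → F) × (Fin 3 → F) // a ⬝ᵥ symVec p.2 p.1 = 0} : ℚ))
    (fun t => (Nat.card F : ℚ) ^ 5 +
        kerValue (Nat.card F) t * ((Nat.card F : ℚ) ^ 3 - (Nat.card F : ℚ) ^ 2))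
    fun a t ht => by
      simp only [← dotProduct_dualMat_mulVec]
      rw [card_pairs_eq, ht.kerCard_eq h2 hε]
  have e : (Nat.card {p : (Fin 3 → F) × (Fin 3 → F) // (0 : Fin 6 → F) ⬝ᵥ symVec p.2 p.1 = 0} :
      ℚ) = (Nat.card F : ℚ) ^ 6 := by
    simp
    ring
  rw [e] at h
  rw [← h, sum_card_orthogonal hy (fun p : (Fin 3 → F) × (Fin 3 → F) => symVec p.2 p.1), prodCard]
  simp only [mem_span_iff_symMat, symMat_symVec]
  simp only [add_comm (Matrix.vecMulVec (Prod.snd _) _)]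
  simp
  ring

/-- The numbers of hyperplanes of each type through a point of a given type. -/
def distValue (q : ℚ) : Fin 4 → Fin 4 → ℚ :=
  ![![q + 1, q ^ 3 + (3 * q ^ 2 + q) / 2, (q ^ 2 - q) / 2, q ^ 4 - q ^ 2],
    ![2 * q + 1, (q ^ 3 + 3 * q ^ 2) / 2, (q ^ 3 + q ^ 2) / 2 - q, q ^ 4 - q ^ 2],
    ![1, (q ^ 3 + 3 * q ^ 2) / 2 + q, (q ^ 3 + q ^ 2) / 2, q ^ 4 - q ^ 2],
    ![q + 1, (q ^ 3 + 2 * q ^ 2 + q) / 2, (q ^ 3 - q) / 2, q ^ 4]]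

/-- The linear system satisfied by the numbers of vectors of each type has a unique solution. -/
theorem linear_system_unique {q d z i n0 n1 n2 n3 : ℚ} (hq : 1 < q) {m0 m1 m2 m3 : ℚ}
    (a : 1 + (n0 + n1 + n2 + n3) = q ^ 5)
    (b : q ^ 3 + (n0 * q ^ 2 + n1 * (2 * q ^ 2 - q) + n2 * q + n3 * q ^ 2) =
      q ^ 7 + d * (q ^ 5 - q ^ 4))
    (c : q ^ 6 + (n0 * (q ^ 5 + q ^ 2 * (q ^ 3 - q ^ 2)) + n1 * (q ^ 5 + q * (q ^ 3 - q ^ 2)) +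
      n2 * (q ^ 5 + q * (q ^ 3 - q ^ 2)) + n3 * (q ^ 5 + 1 * (q ^ 3 - q ^ 2))) =
      q ^ 10 + z * (q ^ 5 - q ^ 4)) (h0 : n0 = i - 1)
    (a' : 1 + (m0 + m1 + m2 + m3) = q ^ 5)
    (b' : q ^ 3 + (m0 * q ^ 2 + m1 * (2 * q ^ 2 - q) + m2 * q + m3 * q ^ 2) =
      q ^ 7 + d * (q ^ 5 - q ^ 4))
    (c' : q ^ 6 + (m0 * (q ^ 5 + q ^ 2 * (q ^ 3 - q ^ 2)) + m1 * (q ^ 5 + q * (q ^ 3 - q ^ 2)) +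
      m2 * (q ^ 5 + q * (q ^ 3 - q ^ 2)) + m3 * (q ^ 5 + 1 * (q ^ 3 - q ^ 2))) =
      q ^ 10 + z * (q ^ 5 - q ^ 4)) (h0' : m0 = i - 1) :
    n0 = m0 ∧ n1 = m1 ∧ n2 = m2 ∧ n3 = m3 := by
  have e0 : n0 = m0 := h0.trans h0'.symm
  subst e0
  have hk : q ^ 2 * (q - 1) ^ 2 ≠ 0 :=
    mul_ne_zero (pow_ne_zero _ (by linarith)) (pow_ne_zero _ (by linarith))
  have hl : q * (q - 1) ≠ 0 := mul_ne_zero (by linarith) (by linarith)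
  -- Subtracting the total times the weight q⁵ + q³ − q² of type 3 removes n₃ and leaves the common
  -- coefficient q²(q − 1)² on n₁ and n₂.
  have s1 : n1 + n2 = m1 + m2 := by
    apply mul_left_cancel₀ hk
    linear_combination c - c' - (q ^ 5 + q ^ 3 - q ^ 2) * (a - a')
  -- Types 0 and 3 both have q² isotropic vectors, so subtracting q² times the total leaves q(q −
  -- 1)(n₁ − n₂).
  have s2 : n1 - n2 = m1 - m2 := by
    apply mul_left_cancel₀ hl
    linear_combination b - b' - q ^ 2 * (a - a')
  have e1 : n1 = m1 := by linarith
  have e2 : n2 = m2 := by linarith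
  exact ⟨rfl, e1, e2, by linarith⟩

/-- The counts and the claimed values solve the same linear system, whose right-hand sides depend
only on the type of `y`; for the claimed values this is a polynomial identity in q. -/
theorem typeCard_eq [Finite F] (h2 : (2 : F) ≠ 0) {ε : F} (hε : ¬IsSquare ε)
    {y : Fin 6 → F} {s : Fin 4} (hs : HasType ε s (symMat y)) (t : Fin 4) :
    (typeCard ε t y : ℚ) = ((Nat.card F : ℚ) - 1) * distValue (Nat.card F) s t := by
  have hy : y ≠ 0 := by
    rintro rfl
    exact hs.ne_zero h2 symMat_zero
  have hq : (1 : ℚ) < Nat.card F := by exact_mod_cast Finite.one_lt_card (α := F)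
  have a := typeCard_sum h2 hε hy
  have b := typeCard_sum_isoValue h2 hε hy
  have c := typeCard_sum_kerValue h2 hε hy
  have d := typeCard_zero h2 ε y
  have hd : (sqCard (symMat y) : ℚ) = ![(Nat.card F : ℚ), 1, 1, 1] s := by
    by_cases h0 : s = 0
    · subst h0
      rw [hs.sqCard_eq_zero]
      rfl
    · rw [sqCard_eq_one h2 hε hs h0]
      fin_cases s
      · exact absurd rfl h0
      all_goals simp
  have hz : (prodCard (symMat y) : ℚ) = 2 * (Nat.card F : ℚ) ^ 3 - 1 +
      ![((Nat.card F : ℚ) - 1) ^ 2, 2 * ((Nat.card F : ℚ) - 1) ^ 2, 0, 0] s := by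
    fin_cases s
    · exact hs.prodCard_eq_zero h2 hε
    · exact hs.prodCard_eq_one h2
    · simpa using prodCard_of_two_le h2 hε hs (by decide) (by decide)
    · simpa using prodCard_of_two_le h2 hε hs (by decide) (by decide)
  rw [hs.isoCard_eq h2 hε] at d
  rw [hd] at b
  rw [hz] at c
  simp only [Fin.sum_univ_four] at a b c
  generalize (Nat.card F : ℚ) = q at *
  have key := linear_system_unique (m0 := (q - 1) * distValue q s 0)
    (m1 := (q - 1) * distValue q s 1) (m2 := (q - 1) * distValue q s 2)
    (m3 := (q - 1) * distValue q s 3) hq a b c d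
  fin_cases s <;>
  · obtain ⟨h0, h1, h3, h4⟩ := key (by simp [distValue]; ring) (by simp [distValue]; ring)
      (by simp [distValue]; ring) (by simp [distValue, isoValue] <;> ring)
    fin_cases t
    exacts [h0, h1, h3, h4]

/-! ### Quadratic forms and their coefficients -/

section forms

variable {R : Type*} [CommRing R]

/-- The ternary quadratic form with given coefficients. -/
noncomputable def formOf (a : Fin 6 → R) : MvPolynomial (Fin 3) R :=
  MvPolynomial.C (a 0) * (MvPolynomial.X 0 * MvPolynomial.X 0) +
  MvPolynomial.C (a 1) * (MvPolynomial.X 0 * MvPolynomial.X 1) +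
  MvPolynomial.C (a 2) * (MvPolynomial.X 0 * MvPolynomial.X 2) +
  MvPolynomial.C (a 3) * (MvPolynomial.X 1 * MvPolynomial.X 1) +
  MvPolynomial.C (a 4) * (MvPolynomial.X 1 * MvPolynomial.X 2) +
  MvPolynomial.C (a 5) * (MvPolynomial.X 2 * MvPolynomial.X 2)

/-- The exponent vectors of the monomials of degree two. -/
def exponents : Fin 6 → Fin 3 × Fin 3 := ![(0, 0), (0, 1), (0, 2), (1, 1), (1, 2), (2, 2)]

theorem coeff_X_mul_X (d : Fin 3 →₀ ℕ) (i j : Fin 3) :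
    MvPolynomial.coeff d (MvPolynomial.X i * MvPolynomial.X j : MvPolynomial (Fin 3) R) =
      if Finsupp.single i 1 + Finsupp.single j 1 = d then 1 else 0 := by
  classical
  rw [MvPolynomial.X, MvPolynomial.X, MvPolynomial.monomial_mul, MvPolynomial.coeff_monomial,
    mul_one]

theorem coeff_formOf (a : Fin 6 → R) (k : Fin 6) :
    MvPolynomial.coeff (Finsupp.single (exponents k).1 1 + Finsupp.single (exponents k).2 1)
      (formOf a) = a k := by
  simp only [formOf, MvPolynomial.coeff_add, MvPolynomial.coeff_C_mul, coeff_X_mul_X]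
  fin_cases k <;> simp [exponents, Finsupp.ext_iff, Fin.forall_fin_succ, Finsupp.single_apply]

theorem formOf_injective : Function.Injective (formOf : (Fin 6 → R) → _) := by
  intro a b h
  funext k
  rw [← coeff_formOf a, h, coeff_formOf]

theorem isHomogeneous_formOf (a : Fin 6 → R) : (formOf a).IsHomogeneous 2 := by
  have h : ∀ (c : R) (i j : Fin 3),
      (MvPolynomial.C c * (MvPolynomial.X i * MvPolynomial.X j)).IsHomogeneous 2 := fun c i j => by
    simpa using (MvPolynomial.isHomogeneous_C (Fin 3) c).mul
      ((MvPolynomial.isHomogeneous_X R i).mul (MvPolynomial.isHomogeneous_X R j))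
  exact ((((((h _ _ _).add (h _ _ _)).add (h _ _ _)).add (h _ _ _)).add (h _ _ _)).add (h _ _ _))

theorem exists_exponents_eq {d : Fin 3 →₀ ℕ} (hd : d.degree = 2) :
    ∃ k, Finsupp.single (exponents k).1 1 + Finsupp.single (exponents k).2 1 = d := by
  rw [Finsupp.degree_eq_sum, Fin.sum_univ_three] at hd
  have key : ∀ k, (∀ i, (Finsupp.single (exponents k).1 1 + Finsupp.single (exponents k).2 1 :
      Fin 3 →₀ ℕ) i = d i) → ∃ k, Finsupp.single (exponents k).1 1 +
        Finsupp.single (exponents k).2 1 = d := fun k h => ⟨k, Finsupp.ext h⟩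
  have h0 : d 0 ≤ 2 := by omega
  have h1 : d 1 ≤ 2 := by omega
  have cases : (d 0 = 2 ∧ d 1 = 0 ∧ d 2 = 0) ∨ (d 0 = 1 ∧ d 1 = 1 ∧ d 2 = 0) ∨
      (d 0 = 1 ∧ d 1 = 0 ∧ d 2 = 1) ∨ (d 0 = 0 ∧ d 1 = 2 ∧ d 2 = 0) ∨
      (d 0 = 0 ∧ d 1 = 1 ∧ d 2 = 1) ∨ (d 0 = 0 ∧ d 1 = 0 ∧ d 2 = 2) := by omega
  rcases cases with ⟨h0, h1, h3⟩ | ⟨h0, h1, h3⟩ | ⟨h0, h1, h3⟩ | ⟨h0, h1, h3⟩ | ⟨h0, h1, h3⟩ |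
    ⟨h0, h1, h3⟩
  · exact key 0 fun i => by fin_cases i <;> simp [exponents, h0, h1, h3]
  · exact key 1 fun i => by fin_cases i <;> simp [exponents, h0, h1, h3]
  · exact key 2 fun i => by fin_cases i <;> simp [exponents, h0, h1, h3]
  · exact key 3 fun i => by fin_cases i <;> simp [exponents, h0, h1, h3]
  · exact key 4 fun i => by fin_cases i <;> simp [exponents, h0, h1, h3]
  · exact key 5 fun i => by fin_cases i <;> simp [exponents, h0, h1, h3]

theorem linForm_mul_linForm (v w : Fin 3 → R) :
    linForm v * linForm w = formOf ![v 0 * w 0, v 0 * w 1 + v 1 * w 0, v 0 * w 2 + v 2 * w 0,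
      v 1 * w 1, v 1 * w 2 + v 2 * w 1, v 2 * w 2] := by
  simp [linForm, formOf, Fin.sum_univ_three]
  ring

theorem C_mul_formOf (c : R) (a : Fin 6 → R) : MvPolynomial.C c * formOf a = formOf (c • a) := by
  simp [formOf]
  ring

theorem map_formOf {S : Type*} [CommRing S] (φ : R →+* S) (a : Fin 6 → R) :
    MvPolynomial.map φ (formOf a) = formOf fun i => φ (a i) := by
  simp [formOf]

end forms

theorem coeffVec_apply (f : QForms F) (k : Fin 6) : coeffVec f k =
    MvPolynomial.coeff (Finsupp.single (exponents k).1 1 + Finsupp.single (exponents k).2 1)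
      (f : MvPolynomial (Fin 3) F) := by
  fin_cases k <;> rfl

theorem formOf_coeffVec (f : QForms F) : formOf (coeffVec f) = (f : MvPolynomial (Fin 3) F) := by
  ext d
  by_cases hd : d.degree = 2
  · obtain ⟨k, rfl⟩ := exists_exponents_eq hd
    rw [coeff_formOf, coeffVec_apply]
  · rw [(isHomogeneous_formOf _).coeff_eq_zero hd,
      ((MvPolynomial.mem_homogeneousSubmodule _ _).1 f.2).coeff_eq_zero hd]

theorem coe_eq_formOf_iff (f : QForms F) (a : Fin 6 → F) :
    (f : MvPolynomial (Fin 3) F) = formOf a ↔ coeffVec f = a := by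
  rw [← formOf_coeffVec, formOf_injective.eq_iff]

/-- Quadratic forms correspond linearly to their coefficient vectors. -/
noncomputable def coeffEquiv : QForms F ≃ₗ[F] (Fin 6 → F) where
  toFun := coeffVec
  invFun a := ⟨formOf a, (MvPolynomial.mem_homogeneousSubmodule _ _).2 (isHomogeneous_formOf a)⟩
  left_inv f := Subtype.ext (formOf_coeffVec f)
  right_inv a := by
    funext k
    rw [coeffVec_apply]
    exact coeff_formOf a k
  map_add' f g := by
    funext k
    simp [coeffVec_apply]
  map_smul' c f := by
    funext k
    simp [coeffVec_apply]

@[simp]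
theorem coeffEquiv_apply (f : QForms F) : coeffEquiv f = coeffVec f := rfl

theorem coeffVec_rep_ne_zero (C : Conic F) : coeffVec C.rep ≠ 0 := by
  rw [← coeffEquiv_apply]
  exact fun h => C.rep_nonzero ((LinearEquiv.map_eq_zero_iff _).1 h)

theorem dualMat_ne_zero (h2 : (2 : F) ≠ 0) {a : Fin 6 → F} (ha : a ≠ 0) : dualMat a ≠ 0 :=
  fun h => ha (dualMat_injective h2 (h.trans dualMat_zero.symm))

/-! ### The types of conics -/

theorem isDoubleLine_iff (h2 : (2 : F) ≠ 0) (ε : F) (C : Conic F) :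
    IsDoubleLine C ↔ HasType ε 0 (dualMat (coeffVec C.rep)) := by
  rw [hasType_zero_dualMat_iff h2]
  refine exists_congr fun c => exists_congr fun v => ?_
  have e : MvPolynomial.C c * linForm v ^ 2 = formOf (c • prodVec v v) := by
    rw [pow_two, linForm_mul_linForm, C_mul_formOf]
    rfl
  rw [e, coe_eq_formOf_iff]
  constructor
  -- A conic is a nonzero form, so neither the scalar nor the linear form can vanish.
  · intro h
    have h0 := coeffVec_rep_ne_zero C
    rw [h] at h0
    refine ⟨fun hc => h0 (by rw [hc, zero_smul]), fun hv => h0 ?_, h⟩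
    subst hv
    funext i
    fin_cases i <;> simp [prodVec]
  · exact fun h => h.2.2

theorem isRealLinePair_iff (h2 : (2 : F) ≠ 0) (ε : F) (C : Conic F) :
    IsRealLinePair C ↔ HasType ε 1 (dualMat (coeffVec C.rep)) := by
  rw [hasType_one_iff]
  refine exists_congr fun v => exists_congr fun w => and_congr_right fun _ => ?_
  have e : linForm v * linForm w = formOf (prodVec v w) := linForm_mul_linForm v w
  rw [e, coe_eq_formOf_iff, ← (dualMat_injective h2).eq_iff, dualMat_prodVec]

theorem isNonsingular_iff [Finite F] (h2 : (2 : F) ≠ 0) (ε : F) (C : Conic F) :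
    IsNonsingular C ↔ HasType ε 3 (dualMat (coeffVec C.rep)) := by
  rw [hasType_three_iff h2 (isSymm_dualMat _), det_dualMat, IsNonsingular]
  simp [h2]

/-! ### The quadratic extension and imaginary line pairs -/

section imaginary

variable {L : Type*} [Field L] [Algebra F L]

/-- A quadratic extension of a finite field is generated by a square root of a nonsquare. -/
theorem exists_sqrt [Finite F] (h2 : (2 : F) ≠ 0) (hL : Module.finrank F L = 2) {ε : F}
    (hε : ¬IsSquare ε) : ∃ α : L, α ^ 2 = algebraMap F L ε ∧ α ^ Nat.card F = -α ∧
      ∀ z : L, ∃ x y : F, z = algebraMap F L x + algebraMap F L y * α := by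
  have := Fintype.ofFinite F
  have hfin : Module.Finite F L := Module.finite_of_finrank_pos (by omega)
  have : Finite L := Module.finite_of_finite F
  have := Fintype.ofFinite L
  have hcL : Fintype.card L = Fintype.card F ^ 2 := by
    rw [← hL]
    exact Module.card_eq_pow_finrank
  have hodd : Fintype.card F % 2 = 1 := by
    rcases Nat.mod_two_eq_zero_or_one (Fintype.card F) with h | h
    · rw [← FiniteField.even_card_iff_char_two] at h
      exact absurd (by exact_mod_cast h ▸ ringChar.Nat.cast_ringChar (R := F)) h2
    · exact h
  have hchF : ringChar F ≠ 2 := fun h => by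
    rw [FiniteField.even_card_iff_char_two] at h
    omega
  have hchL : ringChar L ≠ 2 := fun h => by
    rw [FiniteField.even_card_iff_char_two, hcL, Nat.pow_mod, hodd] at h
    simp at h
  have hε0 : ε ≠ 0 := fun h => hε (h ▸ IsSquare.zero)
  have hεL : algebraMap F L ε ≠ 0 := by simpa using hε0
  obtain ⟨k, hk⟩ : ∃ k, Fintype.card F = 2 * k + 1 := ⟨Fintype.card F / 2, by omega⟩
  -- Euler's criterion, with natural division giving (q − 1)/2. In L the exponent is (q² − 1)/2 = (q
  -- − 1)/2 · (q + 1) with q + 1 even, so ε becomes a square.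
  have hpow : ε ^ (Fintype.card F / 2) = -1 :=
    (FiniteField.pow_dichotomy hchF hε0).resolve_left
      fun h => hε ((FiniteField.isSquare_iff hchF hε0).2 h)
  have hsq : IsSquare (algebraMap F L ε) := by
    rw [FiniteField.isSquare_iff hchL hεL, ← map_pow, hcL]
    have e : Fintype.card F ^ 2 / 2 = Fintype.card F / 2 * (2 * (k + 1)) := by
      rw [hk]
      have h1 : (2 * k + 1) ^ 2 = 2 * (2 * k * (k + 1)) + 1 := by ring
      have h3 : (2 * k + 1) / 2 = k := by omega
      rw [h1, h3]
      have : (2 * (2 * k * (k + 1)) + 1) / 2 = 2 * k * (k + 1) := by omega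
      rw [this]
      ring
    rw [e, pow_mul, hpow, pow_mul]
    simp
  obtain ⟨α, hα⟩ := hsq
  have hnot : ∀ x : F, algebraMap F L x ≠ α := by
    rintro x rfl
    refine hε ⟨x, (algebraMap F L).injective ?_⟩
    rw [hα, map_mul]
  refine ⟨α, by rw [hα, pow_two], ?_, ?_⟩
  -- α^q = (α²)^((q−1)/2) · α = ε^((q−1)/2) · α = −α.
  · rw [Nat.card_eq_fintype_card, hk, pow_succ, pow_mul, pow_two, ← hα, ← map_pow]
    have : Fintype.card F / 2 = k := by omega
    rw [← this, hpow]
    simp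
  · have hli : LinearIndependent F ![(1 : L), α] := by
      rw [LinearIndependent.pair_iff' one_ne_zero]
      intro x hx
      exact hnot x (by rw [← hx, Algebra.smul_def, mul_one])
    intro z
    have htop := hli.span_eq_top_of_card_eq_finrank (by simp [hL])
    have hz : z ∈ Submodule.span F (Set.range ![(1 : L), α]) := htop ▸ Submodule.mem_top
    rw [Matrix.range_cons, Matrix.range_cons, Matrix.range_empty, Set.union_empty,
      Set.singleton_union, Submodule.mem_span_pair] at hz
    obtain ⟨x, y, h⟩ := hz
    exact ⟨x, y, by rw [← h, Algebra.smul_def, Algebra.smul_def, mul_one]⟩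

end imaginary

section imaginary

variable {L : Type*} [Field L] [Algebra F L]

/-- Bilinearity and antisymmetry reduce independence of two conjugate vectors over L to that of x
and y over F. -/
theorem cross_conj (α : L) (x y : Fin 3 → F) :
    (fun i => algebraMap F L (x i) + algebraMap F L (y i) * α) ⨯₃
      (fun i => algebraMap F L (x i) - algebraMap F L (y i) * α) =
    (-2 * α) • fun i => algebraMap F L ((x ⨯₃ y) i) := by
  funext i
  fin_cases i <;> simp [cross_apply] <;> ring

/-- The norm (x + yα)(x − yα) = x² − εy² matches the representative of type 2. -/
theorem prodVec_conj {α : L} {ε : F} (hα : α ^ 2 = algebraMap F L ε) (x y : Fin 3 → F) :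
    prodVec (fun i => algebraMap F L (x i) + algebraMap F L (y i) * α)
      (fun i => algebraMap F L (x i) - algebraMap F L (y i) * α) =
    fun i => algebraMap F L ((prodVec x x - ε • prodVec y y) i) := by
  funext i
  fin_cases i <;> simp [prodVec, ← hα] <;> ring

theorem conj_pow [Finite F] {α : L} (hα : α ^ Nat.card F = -α) (x y : F) :
    (algebraMap F L x + algebraMap F L y * α) ^ Nat.card F =
      algebraMap F L x - algebraMap F L y * α := by
  have := Fintype.ofFinite F
  have h := map_add (FiniteField.frobeniusAlgHom F L) (algebraMap F L x) (algebraMap F L y * α)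
  rw [map_mul] at h
  simp only [AlgHom.commutes] at h
  simp only [FiniteField.coe_frobeniusAlgHom, ← Nat.card_eq_fintype_card, hα] at h
  rw [h]
  ring

theorem dualMat_sub_smul (ε : F) (x y : Fin 3 → F) :
    dualMat (prodVec x x - ε • prodVec y y) =
      (2 : F) • (Matrix.vecMulVec x x - ε • Matrix.vecMulVec y y) := by
  ext i j
  fin_cases i <;> fin_cases j <;> simp [dualMat, prodVec, Matrix.vecMulVec_apply] <;> ring

theorem isImagLinePair_iff [Finite F] (h2 : (2 : F) ≠ 0) (hL : Module.finrank F L = 2) {ε : F}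
    (hε : ¬IsSquare ε) (C : Conic F) :
    IsImagLinePair L C ↔ HasType ε 2 (dualMat (coeffVec C.rep)) := by
  obtain ⟨α, hα, hαq, hgen⟩ := exists_sqrt (L := L) h2 hL hε
  have h2L : (2 : L) ≠ 0 := by
    rw [← map_ofNat (algebraMap F L) 2]
    exact (map_ne_zero (algebraMap F L)).2 h2
  have hα0 : α ≠ 0 := by
    rintro rfl
    refine hε ⟨0, (algebraMap F L).injective ?_⟩
    rw [← hα]
    simp
  have hinj := (algebraMap F L).injective
  have key : ∀ (a : L) (v w : Fin 3 → L),
      MvPolynomial.map (algebraMap F L) (C.rep : MvPolynomial (Fin 3) F) =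
        MvPolynomial.C a * linForm v * linForm w ↔
      (fun i => algebraMap F L (coeffVec C.rep i)) = a • prodVec v w := by
    intro a v w
    rw [← formOf_coeffVec, map_formOf, mul_assoc, linForm_mul_linForm, C_mul_formOf,
      formOf_injective.eq_iff]
    rfl
  have hpair : ∀ x y : Fin 3 → F,
      LinearIndependent L ![fun i => algebraMap F L (x i) + algebraMap F L (y i) * α,
        fun i => algebraMap F L (x i) - algebraMap F L (y i) * α] ↔
      LinearIndependent F ![x, y] := by
    intro x y
    rw [← crossProduct_ne_zero_iff_linearIndependent, ← crossProduct_ne_zero_iff_linearIndependent,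
      cross_conj, ne_eq, ne_eq, smul_eq_zero_iff_right (mul_ne_zero (neg_ne_zero.2 h2L) hα0),
      not_iff_not]
    simp [funext_iff]
  rw [hasType_two_iff, IsImagLinePair]
  constructor
  · rintro ⟨a, v, hli, hv⟩
    rw [key] at hv
    choose x y hxy using fun i => hgen (v i)
    have ev : v = fun i => algebraMap F L (x i) + algebraMap F L (y i) * α := funext hxy
    subst ev
    simp only [conj_pow hαq] at hli hv
    rw [prodVec_conj hα] at hv
    rw [hpair] at hli
    -- The scalar `a` is only known to lie in L; comparing one nonzero coefficient shows that it
    -- comes from F.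
    obtain ⟨k, hk⟩ := Function.ne_iff.1 (coeffVec_rep_ne_zero C)
    set d := prodVec x x - ε • prodVec y y with hd
    have hdk : d k ≠ 0 := by
      intro h0
      have := congrFun hv k
      simp only [Pi.smul_apply, h0, map_zero, smul_zero] at this
      exact hk (by simpa using this)
    have ea : a = algebraMap F L (coeffVec C.rep k / d k) := by
      have := congrFun hv k
      simp only [Pi.smul_apply, smul_eq_mul] at this
      rw [map_div₀, this, mul_div_cancel_right₀]
      simpa using hdk
    have ec : coeffVec C.rep = (coeffVec C.rep k / d k) • d := by
      funext i
      apply hinj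
      have := congrFun hv i
      rw [ea] at this
      simpa using this
    refine ⟨coeffVec C.rep k / d k * 2, x, y, mul_ne_zero (div_ne_zero hk hdk) h2, hli, ?_⟩
    conv_lhs => rw [ec]
    rw [dualMat_smul, hd, dualMat_sub_smul, smul_smul]
  · rintro ⟨c, x, y, hc, hli, h⟩
    refine ⟨algebraMap F L (c / 2), fun i => algebraMap F L (x i) + algebraMap F L (y i) * α,
      ?_, ?_⟩
    · simp only [conj_pow hαq]
      exact (hpair x y).2 hli
    · rw [key]
      simp only [conj_pow hαq]
      rw [prodVec_conj hα]
      have ec : coeffVec C.rep = (c / 2) • (prodVec x x - ε • prodVec y y) := by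
        apply dualMat_injective h2
        rw [h, dualMat_smul, dualMat_sub_smul, smul_smul, div_mul_cancel₀ _ h2]
      rw [ec]
      funext i
      simp

end imaginary

/-! ### Hyperplanes -/

/-- The hyperplane with coefficient vector `a`. -/
def hyperplaneOf (a : Fin 6 → F) : Submodule F (Fin 6 → F) := LinearMap.ker (dotLin a)

theorem mem_hyperplaneOf {a y : Fin 6 → F} : y ∈ hyperplaneOf a ↔ a ⬝ᵥ y = 0 := by
  rw [dotProduct_comm]
  rfl

theorem conicHyperplane_eq (C : Conic F) : conicHyperplane C = hyperplaneOf (coeffVec C.rep) := by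
  ext y
  rw [mem_hyperplaneOf]
  rfl

theorem hyperplaneOf_smul {c : F} (hc : c ≠ 0) (a : Fin 6 → F) :
    hyperplaneOf (c • a) = hyperplaneOf a := by
  ext y
  rw [mem_hyperplaneOf, mem_hyperplaneOf, smul_dotProduct, smul_eq_zero_iff_right hc]

theorem exists_smul_of_hyperplaneOf_le {a b : Fin 6 → F} (hb : b ≠ 0)
    (h : hyperplaneOf a ≤ hyperplaneOf b) : ∃ c : F, c ≠ 0 ∧ b = c • a := by
  have hm := mem_span_of_dotProduct (y := a) (b := b) fun y hy => by
    rw [dotProduct_comm] at hy ⊢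
    exact mem_hyperplaneOf.1 (h (mem_hyperplaneOf.2 hy))
  obtain ⟨c, rfl⟩ := Submodule.mem_span_singleton.1 hm
  refine ⟨c, ?_, rfl⟩
  rintro rfl
  exact hb (zero_smul _ _)

theorem finrank_hyperplaneOf {a : Fin 6 → F} (ha : a ≠ 0) :
    Module.finrank F (hyperplaneOf a) = 5 := by
  have h := LinearMap.finrank_range_add_finrank_ker (dotLin a)
  rw [LinearMap.range_eq_top.2 (LinearMap.surjective (dotLin_ne_zero ha)), finrank_top,
    Module.finrank_self, Module.finrank_fin_fun] at h
  change Module.finrank F (LinearMap.ker (dotLin a)) = 5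
  omega

theorem exists_eq_hyperplaneOf {H : Submodule F (Fin 6 → F)} (hH : Module.finrank F H = 5) :
    ∃ a, a ≠ 0 ∧ H = hyperplaneOf a := by
  have hlt : H < ⊤ := by
    rw [lt_top_iff_ne_top]
    rintro rfl
    simp at hH
  obtain ⟨f, hf, hle⟩ := Submodule.exists_le_ker_of_lt_top H hlt
  have ef : f = dotLin fun i => f (Pi.single i 1) := by
    apply LinearMap.pi_ext'
    intro i
    ext
    simp [dotLin]
  have ha : (fun i => f (Pi.single i 1)) ≠ 0 := by
    intro h0
    rw [h0] at ef
    apply hf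
    rw [ef]
    ext
    simp [dotLin]
  refine ⟨_, ha, ?_⟩
  refine Submodule.eq_of_le_of_finrank_eq ?_ (by rw [hH, finrank_hyperplaneOf ha])
  change H ≤ LinearMap.ker (dotLin _)
  rwa [← ef]

/-- A hyperplane determines its normal vector up to a scalar, so counting hyperplanes is counting
conics. -/
theorem conicHyperplane_injective : Function.Injective (conicHyperplane (F := F)) := by
  intro C D h
  rw [conicHyperplane_eq, conicHyperplane_eq] at h
  obtain ⟨c, hc, h'⟩ := exists_smul_of_hyperplaneOf_le (coeffVec_rep_ne_zero D) h.le
  rw [← C.mk_rep, ← D.mk_rep, Projectivization.mk_eq_mk_iff']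
  refine ⟨c⁻¹, coeffEquiv.injective ?_⟩
  rw [map_smul, coeffEquiv_apply, coeffEquiv_apply, h', inv_smul_smul₀ hc]

/-- The hyperplanes whose coefficient vectors are of type `t`. -/
def typeHyperplanes (ε : F) (t : Fin 4) : Set (Submodule F (Fin 6 → F)) :=
  {H | ∃ a, HasType ε t (dualMat a) ∧ H = hyperplaneOf a}

/-- The conics of type `t`. -/
def typeConics (ε : F) (t : Fin 4) : Set (Conic F) := {C | HasType ε t (dualMat (coeffVec C.rep))}

theorem exists_conic (a : Fin 6 → F) (ha : a ≠ 0) :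
    ∃ (C : Conic F) (c : F), c ≠ 0 ∧ coeffVec C.rep = c • a := by
  have hf : coeffEquiv.symm a ≠ 0 := fun h => ha ((LinearEquiv.map_eq_zero_iff _).1 h)
  obtain ⟨c, hc⟩ := Projectivization.exists_smul_eq_mk_rep F (coeffEquiv.symm a) hf
  refine ⟨Projectivization.mk F _ hf, c, c.ne_zero, ?_⟩
  rw [← coeffEquiv_apply, ← hc, Units.smul_def, map_smul, LinearEquiv.apply_symm_apply]

theorem image_typeConics (h2 : (2 : F) ≠ 0) (ε : F) (t : Fin 4) :
    conicHyperplane '' typeConics ε t = typeHyperplanes ε t := by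
  ext H
  constructor
  · rintro ⟨C, hC, rfl⟩
    exact ⟨_, hC, conicHyperplane_eq C⟩
  · rintro ⟨a, ha, rfl⟩
    have ha0 : a ≠ 0 := by
      rintro rfl
      exact ha.ne_zero h2 dualMat_zero
    obtain ⟨C, c, hc, h⟩ := exists_conic a ha0
    refine ⟨C, ?_, ?_⟩
    · change HasType ε t (dualMat _)
      rw [h, dualMat_smul]
      exact ha.smul hc
    · rw [conicHyperplane_eq, h, hyperplaneOf_smul hc]

theorem hyperplaneOf_mem_typeHyperplanes_iff (h2 : (2 : F) ≠ 0) {ε : F} {t : Fin 4}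
    {a : Fin 6 → F} : hyperplaneOf a ∈ typeHyperplanes ε t ↔ HasType ε t (dualMat a) := by
  constructor
  · rintro ⟨b, hb, h⟩
    have hb0 : b ≠ 0 := by
      rintro rfl
      exact hb.ne_zero h2 dualMat_zero
    obtain ⟨c, hc, rfl⟩ := exists_smul_of_hyperplaneOf_le hb0 h.le
    rw [dualMat_smul] at hb
    exact hb.of_smul hc
  · exact fun h => ⟨a, h, rfl⟩

/-! ### The group action -/

theorem symMat_congrMap (A : Matrix (Fin 3) (Fin 3) F) (y : Fin 6 → F) :
    symMat (congrMap A y) = A * symMat y * Aᵀ := by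
  refine symMat_upperEntries ?_
  simp [Matrix.IsSymm, Matrix.transpose_mul, (isSymm_symMat y).eq, Matrix.mul_assoc]

/-- Congruence transforms hyperplanes contragrediently. -/
theorem hyperplaneOf_map_congrMap (h2 : (2 : F) ≠ 0) {A : Matrix (Fin 3) (Fin 3) F}
    (hA : A.det ≠ 0) {a b : Fin 6 → F} (h : dualMat a = Aᵀ * dualMat b * A) :
    (hyperplaneOf a).map (congrMap A) = hyperplaneOf b := by
  have hu : IsUnit A.det := isUnit_iff_ne_zero.2 hA
  -- Cyclicity of the trace: tr(B · AMAᵀ) = tr(AᵀBA · M).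
  have key : ∀ y, b ⬝ᵥ congrMap A y = a ⬝ᵥ y := by
    intro y
    apply mul_left_cancel₀ h2
    rw [← trace_dualMat_mul_symMat, ← trace_dualMat_mul_symMat, symMat_congrMap, h,
      ← Matrix.mul_assoc, Matrix.trace_mul_comm]
    simp only [Matrix.mul_assoc]
  ext z
  simp only [Submodule.mem_map, mem_hyperplaneOf]
  constructor
  · rintro ⟨y, hy, rfl⟩
    rw [key, hy]
  · intro hz
    have e : congrMap A (congrMap A⁻¹ z) = z := by
      apply symMat_injective
      rw [symMat_congrMap, symMat_congrMap, ← Matrix.mul_assoc, ← Matrix.mul_assoc,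
        Matrix.mul_nonsing_inv _ hu, Matrix.one_mul, Matrix.mul_assoc, ← Matrix.transpose_mul,
        Matrix.mul_nonsing_inv _ hu, Matrix.transpose_one, Matrix.mul_one]
    exact ⟨congrMap A⁻¹ z, by rw [← key, e, hz], e⟩

theorem det_coe_ne_zero (A : GL (Fin 3) F) : (A : Matrix (Fin 3) (Fin 3) F).det ≠ 0 :=
  ((Matrix.isUnit_iff_isUnit_det _).1 A.isUnit).ne_zero

theorem exists_map_congrMap_eq (h2 : (2 : F) ≠ 0) {A : Matrix (Fin 3) (Fin 3) F}
    (hA : A.det ≠ 0) (a : Fin 6 → F) :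
    ∃ b, Sim (dualMat a) (dualMat b) ∧ (hyperplaneOf a).map (congrMap A) = hyperplaneOf b := by
  have hu : IsUnit A.det := isUnit_iff_ne_zero.2 hA
  obtain ⟨b, hb⟩ := exists_dualMat_eq h2 (S := A⁻¹ᵀ * dualMat a * A⁻¹) (by
    simp [Matrix.IsSymm, Matrix.transpose_mul, (isSymm_dualMat a).eq, Matrix.mul_assoc])
  have e : dualMat a = Aᵀ * dualMat b * A := by
    rw [hb, Matrix.mul_assoc, Matrix.mul_assoc, Matrix.nonsing_inv_mul _ hu, Matrix.mul_one,
      ← Matrix.mul_assoc, ← Matrix.transpose_mul, Matrix.nonsing_inv_mul _ hu,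
      Matrix.transpose_one, Matrix.one_mul]
  refine ⟨b, Sim.symm ?_, hyperplaneOf_map_congrMap h2 hA e⟩
  rw [e]
  simpa using Sim.congr (dualMat b) (A := Aᵀ) (by rwa [Matrix.det_transpose])

theorem exists_map_congrMap_iff (h2 : (2 : F) ≠ 0) {a b : Fin 6 → F} (hb : b ≠ 0) :
    (∃ A : GL (Fin 3) F, hyperplaneOf b = (hyperplaneOf a).map (congrMap (A : Matrix _ _ F))) ↔
      Sim (dualMat a) (dualMat b) := by
  constructor
  · rintro ⟨A, h⟩
    obtain ⟨a', hs, ha'⟩ := exists_map_congrMap_eq h2 (det_coe_ne_zero A) a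
    rw [ha'] at h
    obtain ⟨c, hc, rfl⟩ := exists_smul_of_hyperplaneOf_le hb h.ge
    rw [dualMat_smul]
    exact hs.trans (Sim.smul _ hc)
  · intro h
    -- The transpose of `A` is the group element, since hyperplanes transform contragrediently; the
    -- scalar is absorbed by replacing `b` with `c • b`.
    obtain ⟨A, c, hA, hc, h⟩ := h.symm
    refine ⟨Matrix.GeneralLinearGroup.mkOfDetNeZero Aᵀ (by rwa [Matrix.det_transpose]), ?_⟩
    rw [← hyperplaneOf_smul hc b]
    refine (hyperplaneOf_map_congrMap h2 (by simpa using hA) ?_).symm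
    rw [h, dualMat_smul]
    simp [Matrix.GeneralLinearGroup.mkOfDetNeZero]

/-- A classification of the elements of a set by an invariant describes the classes. -/
theorem image_classes_eq {X : Type*} {D : Set X} {r : X → X → Prop} {T : Fin 4 → Set X}
    (hne : ∀ t, (T t).Nonempty) (hcov : ∀ x ∈ D, ∃ t, x ∈ T t) (hsub : ∀ t, T t ⊆ D)
    (hdisj : ∀ s t x, x ∈ T s → x ∈ T t → s = t)
    (hr : ∀ t, ∀ x ∈ T t, {y | r x y} = T t) :
    (fun x => {y | r x y}) '' D = {T 0, T 1, T 2, T 3} ∧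
      ((fun x => {y | r x y}) '' D).ncard = 4 := by
  have h : (fun x => {y | r x y}) '' D = Set.range T := by
    ext U
    constructor
    · rintro ⟨x, hx, rfl⟩
      obtain ⟨t, ht⟩ := hcov x hx
      exact ⟨t, (hr t x ht).symm⟩
    · rintro ⟨t, rfl⟩
      obtain ⟨x, hx⟩ := hne t
      exact ⟨x, hsub t hx, hr t x hx⟩
  have hinj : Function.Injective T := by
    intro s t hst
    obtain ⟨x, hx⟩ := hne s
    exact hdisj s t x hx (hst ▸ hx)
  refine ⟨?_, ?_⟩
  · rw [h]
    ext U
    simp [Fin.exists_fin_succ, eq_comm]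
  · rw [h, ← Set.image_univ, Set.ncard_image_of_injective _ hinj, Set.ncard_univ]
    simp

theorem hyperplaneOrbits_eq [Finite F] (h2 : (2 : F) ≠ 0) {ε : F} (hε : ¬IsSquare ε) :
    hyperplaneOrbits F = {typeHyperplanes ε 0, typeHyperplanes ε 1, typeHyperplanes ε 2,
      typeHyperplanes ε 3} ∧ (hyperplaneOrbits F).ncard = 4 := by
  have hT0 : ∀ {t : Fin 4} {a : Fin 6 → F}, HasType ε t (dualMat a) → a ≠ 0 := by
    rintro t a ha rfl
    exact ha.ne_zero h2 dualMat_zero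
  have hsub : ∀ t, typeHyperplanes ε t ⊆ {H | Module.finrank F H = 5} := by
    rintro t H ⟨a, ha, rfl⟩
    exact finrank_hyperplaneOf (hT0 ha)
  refine image_classes_eq (T := typeHyperplanes ε) ?_ ?_ hsub ?_ ?_
  · intro t
    obtain ⟨a, ha⟩ := exists_dualMat_eq h2 (isSymm_typeRep ε t)
    refine ⟨hyperplaneOf a, a, ?_, rfl⟩
    rw [ha]
    exact Sim.refl _
  · intro H hH
    obtain ⟨a, ha, rfl⟩ := exists_eq_hyperplaneOf hH
    obtain ⟨t, ht⟩ := exists_hasType h2 hε (isSymm_dualMat a) (dualMat_ne_zero h2 ha)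
    exact ⟨t, a, ht, rfl⟩
  · rintro s t H ⟨a, ha, rfl⟩ h
    rw [hyperplaneOf_mem_typeHyperplanes_iff h2] at h
    exact ha.unique h2 hε h
  · rintro t H ⟨a, ha, rfl⟩
    ext H'
    constructor
    · rintro ⟨A, hA⟩
      obtain ⟨b, hs, hb⟩ := exists_map_congrMap_eq h2 (det_coe_ne_zero A) a
      exact ⟨b, ha.sim_iff.1 hs, hA.trans hb⟩
    · rintro ⟨b, hb, rfl⟩
      exact (exists_map_congrMap_iff h2 (hT0 hb)).2 (ha.sim_iff.2 hb)

/-! ### Tangent lines of conics of the Veronese surface -/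

theorem symMat_comb (a b c : F) (v w : Fin 3 → F) :
    symMat (a • veroneseVec v + b • symVec v w + c • veroneseVec w) =
      a • Matrix.vecMulVec v v + b • (Matrix.vecMulVec v w + Matrix.vecMulVec w v) +
        c • Matrix.vecMulVec w w := by
  rw [symMat_add, symMat_add, symMat_smul, symMat_smul, symMat_smul, symMat_veroneseVec,
    symMat_veroneseVec, symMat_symVec]

/-- Completing v, w to an invertible matrix, the combination is congruent to the matrix with upper
left block [[a, b], [b, c]] and zeros elsewhere. -/
theorem eq_zero_of_comb_eq_zero {v w : Fin 3 → F} (h : LinearIndependent F ![v, w]) {a b c : F}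
    (h0 : a • veroneseVec v + b • symVec v w + c • veroneseVec w = 0) : a = 0 ∧ b = 0 ∧ c = 0 := by
  obtain ⟨x, hx⟩ := exists_det_colMat_ne_zero_iff.2 h
  have h1 := symMat_comb a b c v w
  rw [h0, symMat_zero] at h1
  have h3 : colMat v w x * !![a, b, 0; b, c, 0; 0, 0, 0] * (colMat v w x)ᵀ =
      colMat v w x * 0 * (colMat v w x)ᵀ := by
    rw [Matrix.mul_zero, Matrix.zero_mul, h1]
    ext i j
    fin_cases i <;> fin_cases j <;>
      simp [colMat, Matrix.vecMul, dotProduct, Fin.sum_univ_three, Matrix.vecMulVec_apply] <;>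
      ring
  have h4 := congr_injective hx h3
  exact ⟨congrFun (congrFun h4 0) 0, congrFun (congrFun h4 0) 1, congrFun (congrFun h4 1) 1⟩

theorem veroneseVec_comb (a b : F) (v w : Fin 3 → F) : veroneseVec (a • v + b • w) =
    (a ^ 2) • veroneseVec v + (a * b) • symVec v w + (b ^ 2) • veroneseVec w := by
  funext i
  fin_cases i <;> simp [veroneseVec, symVec] <;> ring

theorem veroneseVec_smul (a : F) (v : Fin 3 → F) :
    veroneseVec (a • v) = (a ^ 2) • veroneseVec v := by
  funext i
  fin_cases i <;> simp [veroneseVec] <;> ring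

theorem mem_veroneseConic {l : Submodule F (Fin 3 → F)} {R : PG5 F} :
    R ∈ veroneseConic l ↔ ∃ (v : Fin 3 → F) (hv : v ≠ 0), v ∈ l ∧
      R = Projectivization.mk F (veroneseVec v) (veroneseVec_ne_zero hv) := by
  constructor
  · rintro ⟨u, hu, rfl⟩
    refine ⟨u.rep, u.rep_nonzero, hu ?_, rfl⟩
    rw [Projectivization.submodule_eq]
    exact Submodule.mem_span_singleton_self _
  · rintro ⟨v, hv, hl, rfl⟩
    refine ⟨Projectivization.mk F v hv, ?_, ?_⟩
    · change Projectivization.submodule _ ≤ l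
      rw [Projectivization.submodule_mk, Submodule.span_singleton_le_iff_mem]
      exact hl
    · obtain ⟨c, hc⟩ := Projectivization.exists_smul_eq_mk_rep F v hv
      rw [veronese, Projectivization.mk_eq_mk_iff']
      exact ⟨(c : F) ^ 2, by rw [← hc, Units.smul_def, veroneseVec_smul]⟩

theorem veroneseVec_mem_pointSpan {l : Submodule F (Fin 3 → F)} {v : Fin 3 → F} (hv : v ∈ l) :
    veroneseVec v ∈ pointSpan (veroneseConic l) := by
  by_cases h0 : v = 0
  · have : veroneseVec v = 0 := by
      rw [h0]
      funext i
      fin_cases i <;> simp [veroneseVec]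
    rw [this]
    exact zero_mem _
  · have hR := mem_veroneseConic.2 ⟨v, h0, hv, rfl⟩
    refine (le_iSup₂_of_le (f := fun (R : PG5 F) (_ : R ∈ veroneseConic l) => R.submodule)
      _ hR le_rfl : _ ≤ pointSpan (veroneseConic l)) ?_
    rw [Projectivization.submodule_mk]
    exact Submodule.mem_span_singleton_self _

/-- Polarization: the symmetrized product is ν(v + w) − ν(v) − ν(w). -/
theorem symVec_mem_pointSpan {l : Submodule F (Fin 3 → F)} {v w : Fin 3 → F} (hv : v ∈ l)
    (hw : w ∈ l) : symVec v w ∈ pointSpan (veroneseConic l) := by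
  have h := veroneseVec_comb 1 1 v w
  have e : symVec v w = veroneseVec ((1 : F) • v + (1 : F) • w) - veroneseVec v -
      veroneseVec w := by
    rw [h]
    module
  rw [e]
  refine sub_mem (sub_mem (veroneseVec_mem_pointSpan ?_) (veroneseVec_mem_pointSpan hv))
    (veroneseVec_mem_pointSpan hw)
  exact add_mem (l.smul_mem _ hv) (l.smul_mem _ hw)

theorem finrank_span_pair_eq_two {V : Type*} [AddCommGroup V] [Module F V] {x y : V}
    (h : LinearIndependent F ![x, y]) : Module.finrank F (Submodule.span F {x, y}) = 2 := by
  have := finrank_span_eq_card h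
  rwa [Matrix.range_cons, Matrix.range_cons, Matrix.range_empty, Set.union_empty,
    Set.singleton_union] at this

/-- If P is the symmetrized product of v and w, the line joining it to ν(v) is tangent there: ν(av +
bw) has coefficient b² at ν(w), so it lies on the line only if b = 0. -/
theorem onTangentLine_of_hasType_one {ε : F} {P : PG5 F} (h : HasType ε 1 (symMat P.rep)) :
    OnTangentLine P := by
  obtain ⟨v, w, hli, hP⟩ := hasType_one_iff.1 h
  rw [← symMat_symVec] at hP
  have hP' := symMat_injective hP
  have hv : v ≠ 0 := hli.ne_zero 0
  have hvl : v ∈ Submodule.span F {v, w} := Submodule.subset_span (by simp)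
  have hwl : w ∈ Submodule.span F {v, w} := Submodule.subset_span (by simp)
  have hPs : P.submodule = Submodule.span F {symVec v w} := by
    rw [Projectivization.submodule_eq, hP']
  refine ⟨Submodule.span F {v, w}, finrank_span_pair_eq_two hli, ?_,
    Submodule.span F {veroneseVec v, symVec v w}, ⟨finrank_span_pair_eq_two ?_, ?_, ?_⟩, ?_⟩
  · rw [hPs, Submodule.span_singleton_le_iff_mem]
    exact symVec_mem_pointSpan hvl hwl
  · rw [LinearIndependent.pair_iff]
    intro s t hst
    have := eq_zero_of_comb_eq_zero hli (c := 0) (by rw [hst, zero_smul, add_zero])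
    exact ⟨this.1, this.2.1⟩
  · rw [Submodule.span_le]
    rintro x (rfl | rfl)
    · exact veroneseVec_mem_pointSpan hvl
    · exact symVec_mem_pointSpan hvl hwl
  · refine ⟨Projectivization.mk F (veroneseVec v) (veroneseVec_ne_zero hv),
      ⟨mem_veroneseConic.2 ⟨v, hv, hvl, rfl⟩, ?_⟩, ?_⟩
    · rw [Projectivization.submodule_mk, Submodule.span_singleton_le_iff_mem]
      exact Submodule.subset_span (by simp)
    · rintro R ⟨hR, hRT⟩
      obtain ⟨u, hu, hul, rfl⟩ := mem_veroneseConic.1 hR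
      rw [Projectivization.submodule_mk, Submodule.span_singleton_le_iff_mem,
        Submodule.mem_span_pair] at hRT
      obtain ⟨s, t, hst⟩ := hRT
      obtain ⟨a, b, rfl⟩ := Submodule.mem_span_pair.1 hul
      have h0 := eq_zero_of_comb_eq_zero hli (a := a ^ 2 - s) (b := a * b - t) (c := b ^ 2) (by
        rw [veroneseVec_comb] at hst
        rw [sub_smul, sub_smul]
        linear_combination (exp := 1) -hst)
      have hb : b = 0 := by simpa using h0.2.2
      subst hb
      rw [Projectivization.mk_eq_mk_iff']
      exact ⟨a ^ 2, by rw [zero_smul, add_zero, veroneseVec_smul]⟩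
  · rw [hPs, Submodule.span_singleton_le_iff_mem]
    exact Submodule.subset_span (by simp)

theorem exists_span_pair_eq {l : Submodule F (Fin 3 → F)} (hl : Module.finrank F l = 2)
    {v : Fin 3 → F} (hv : v ≠ 0) (hvl : v ∈ l) :
    ∃ w, LinearIndependent F ![v, w] ∧ l = Submodule.span F {v, w} := by
  obtain ⟨w, hw⟩ := exists_linearIndependent_pair_of_one_lt_finrank (R := F) (M := l)
    (by omega) (x := ⟨v, hvl⟩) (by simpa using hv)
  have hli : LinearIndependent F ![v, (w : Fin 3 → F)] := by
    have := hw.map' l.subtype l.ker_subtype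
    have e : ![v, (w : Fin 3 → F)] = l.subtype ∘ ![⟨v, hvl⟩, w] := by
      funext i
      fin_cases i <;> rfl
    rwa [e]
  refine ⟨w, hli, (Submodule.eq_of_le_of_finrank_eq ?_ ?_).symm⟩
  · rw [Submodule.span_le]
    rintro x (rfl | rfl)
    · exact hvl
    · exact w.2
  · rw [hl, finrank_span_pair_eq_two hli]

theorem not_onTangentLine_of_hasType_two [Finite F] (h2 : (2 : F) ≠ 0) {ε : F}
    (hε : ¬IsSquare ε) {P : PG5 F} (h : HasType ε 2 (symMat P.rep)) : ¬OnTangentLine P := by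
  rintro ⟨l, hl, hPl, T, ⟨-, -, R, ⟨hRC, hRT⟩, huniq⟩, hPT⟩
  obtain ⟨v, hv, hvl, rfl⟩ := mem_veroneseConic.1 hRC
  obtain ⟨w, hli, rfl⟩ := exists_span_pair_eq hl hv hvl
  rw [Projectivization.submodule_mk, Submodule.span_singleton_le_iff_mem] at hRT
  rw [Projectivization.submodule_eq, Submodule.span_singleton_le_iff_mem] at hPl hPT
  have hspan : pointSpan (veroneseConic (Submodule.span F {v, w})) ≤
      Submodule.span F {veroneseVec v, symVec v w, veroneseVec w} := by
    refine iSup₂_le fun Q hQ => ?_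
    obtain ⟨u, hu, hul, rfl⟩ := mem_veroneseConic.1 hQ
    obtain ⟨a, b, rfl⟩ := Submodule.mem_span_pair.1 hul
    rw [Projectivization.submodule_mk, Submodule.span_singleton_le_iff_mem, veroneseVec_comb,
      Submodule.mem_span_triple]
    exact ⟨_, _, _, rfl⟩
  obtain ⟨a, b, c, habc⟩ := Submodule.mem_span_triple.1 (hspan hPl)
  -- If c = 0, then P is the symmetrized product of v with (a/2)v + bw, hence of type 0 or 1.
  by_cases hc : c = 0
  · have hM : symMat P.rep = Matrix.vecMulVec v ((a / 2) • v + b • w) +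
        Matrix.vecMulVec ((a / 2) • v + b • w) v := by
      rw [← habc, symMat_comb, hc]
      ext i j
      simp [Matrix.vecMulVec_apply]
      field_simp
      ring
    by_cases h0 : (a / 2) • v + b • w = 0
    · rw [h0] at hM
      exact h.ne_zero h2 (by simpa using hM)
    · have key := hasType_one_or_zero_of_ne_zero h2 ε hv h0
      rw [← hM] at key
      rcases key with key | key
      · exact absurd (key.unique h2 hε h) (by decide)
      · exact absurd (key.unique h2 hε h) (by decide)
  · have hu : b • v + c • w ≠ 0 := fun h0 =>
      hc ((LinearIndependent.pair_iff.1 hli) b c h0).2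
    -- If c ≠ 0, the line through ν(v) and P meets the conic again at ν(bv + cw), so it is not
    -- tangent.
    have hT : veroneseVec (b • v + c • w) ∈ T := by
      have e : veroneseVec (b • v + c • w) =
          c • P.rep + (b ^ 2 - a * c) • veroneseVec v := by
        rw [← habc, veroneseVec_comb]
        module
      rw [e]
      exact add_mem (T.smul_mem _ hPT) (T.smul_mem _ hRT)
    have heq := huniq (Projectivization.mk F _ (veroneseVec_ne_zero hu))
      ⟨mem_veroneseConic.2 ⟨_, hu, Submodule.mem_span_pair.2 ⟨b, c, rfl⟩, rfl⟩, by
        simpa only [Projectivization.submodule_mk, Submodule.span_singleton_le_iff_mem] using hT⟩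
    rw [Projectivization.mk_eq_mk_iff'] at heq
    obtain ⟨d, hd⟩ := heq
    rw [veroneseVec_comb] at hd
    have h0 := eq_zero_of_comb_eq_zero hli (a := b ^ 2 - d) (b := b * c) (c := c ^ 2) (by
      rw [sub_smul, hd]
      module)
    exact hc (by simpa using h0.2.2)

/-! ### Orbits on points -/

/-- The points of type `t`. -/
def typePoints (ε : F) (t : Fin 4) : Set (PG5 F) := {P | HasType ε t (symMat P.rep)}

theorem exists_mem_typePoints [Finite F] (h2 : (2 : F) ≠ 0) {ε : F} (hε : ¬IsSquare ε)
    (P : PG5 F) : ∃ t, P ∈ typePoints ε t :=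
  exists_hasType h2 hε (isSymm_symMat _) fun h =>
    P.rep_nonzero (symMat_injective (h.trans symMat_zero.symm))

/-- The rank isolates types 0 and 3; lying on a tangent line separates types 1 and 2. -/
theorem pts_eq_typePoints [Finite F] (h2 : (2 : F) ≠ 0) {ε : F} (hε : ¬IsSquare ε) :
    pts1 F = typePoints ε 0 ∧ pts2e F = typePoints ε 1 ∧ pts2i F = typePoints ε 2 ∧
      pts3 F = typePoints ε 3 := by
  have key : ∀ P : PG5 F, (P ∈ pts1 F ↔ P ∈ typePoints ε 0) ∧
      (P ∈ pts2e F ↔ P ∈ typePoints ε 1) ∧ (P ∈ pts2i F ↔ P ∈ typePoints ε 2) ∧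
      (P ∈ pts3 F ↔ P ∈ typePoints ε 3) := by
    intro P
    obtain ⟨t, ht⟩ := exists_mem_typePoints h2 hε P
    have hr : pointRank P = ![1, 2, 2, 3] t := HasType.rank_eq h2 hε ht
    have hmem : ∀ s, P ∈ typePoints ε s ↔ s = t := fun s =>
      ⟨fun hs => HasType.unique h2 hε hs ht, fun hs => hs ▸ ht⟩
    simp only [hmem, pts1, pts2e, pts2i, pts3, Set.mem_ofPred_eq, hr]
    fin_cases t
    · simp
    · simp [onTangentLine_of_hasType_one ht]
    · simp [not_onTangentLine_of_hasType_two h2 hε ht]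
    · simp
  exact ⟨Set.ext fun P => (key P).1, Set.ext fun P => (key P).2.1,
    Set.ext fun P => (key P).2.2.1, Set.ext fun P => (key P).2.2.2⟩

theorem exists_submodule_eq_map_iff (P Q : PG5 F) :
    (∃ A : GL (Fin 3) F, Q.submodule = P.submodule.map (congrMap (A : Matrix _ _ F))) ↔
      Sim (symMat P.rep) (symMat Q.rep) := by
  constructor
  · rintro ⟨A, h⟩
    rw [Projectivization.submodule_eq, Projectivization.submodule_eq, Submodule.map_span,
      Set.image_singleton, eq_comm, Submodule.span_singleton_eq_span_singleton] at h
    obtain ⟨c, hc⟩ := h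
    refine ⟨A, c, det_coe_ne_zero A, c.ne_zero, ?_⟩
    rw [← hc, Units.smul_def, symMat_smul, symMat_congrMap]
  · rintro ⟨A, c, hA, hc, h⟩
    refine ⟨Matrix.GeneralLinearGroup.mkOfDetNeZero A hA, ?_⟩
    rw [Projectivization.submodule_eq, Projectivization.submodule_eq, Submodule.map_span,
      Set.image_singleton, eq_comm, Submodule.span_singleton_eq_span_singleton]
    refine ⟨Units.mk0 c hc, symMat_injective ?_⟩
    rw [Units.smul_def, symMat_smul, symMat_congrMap, h]
    rfl

theorem nonempty_typePoints (h2 : (2 : F) ≠ 0) (ε : F) (t : Fin 4) :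
    (typePoints ε t).Nonempty := by
  have hS := symMat_upperEntries (isSymm_typeRep ε t)
  have h0 : upperEntries (typeRep ε t) ≠ 0 := by
    intro h
    rw [h, symMat_zero] at hS
    exact HasType.ne_zero h2 (Sim.refl (typeRep ε t)) hS.symm
  obtain ⟨c, hc⟩ := Projectivization.exists_smul_eq_mk_rep F _ h0
  refine ⟨Projectivization.mk F _ h0, ?_⟩
  change HasType ε t (symMat _)
  rw [← hc, Units.smul_def, symMat_smul, hS]
  exact Sim.smul _ c.ne_zero

theorem pointOrbits_eq [Finite F] (h2 : (2 : F) ≠ 0) {ε : F} (hε : ¬IsSquare ε) :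
    pointOrbits F = {typePoints ε 0, typePoints ε 1, typePoints ε 2, typePoints ε 3} ∧
      (pointOrbits F).ncard = 4 := by
  rw [pointOrbits, ← Set.image_univ]
  refine image_classes_eq (T := typePoints ε) (nonempty_typePoints h2 ε)
    (fun P _ => exists_mem_typePoints h2 hε P) (fun _ => Set.subset_univ _)
    (fun s t P hs ht => HasType.unique h2 hε hs ht) fun t P hP => ?_
  ext Q
  exact (exists_submodule_eq_map_iff P Q).trans (HasType.sim_iff hP)

/-! ### Hyperplane-orbit distributions -/

theorem eq_of_coeffVec_rep_eq_smul {C D : Conic F} {c : F}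
    (h : coeffVec C.rep = c • coeffVec D.rep) : C = D := by
  rw [← C.mk_rep, ← D.mk_rep, Projectivization.mk_eq_mk_iff']
  refine ⟨c, coeffEquiv.injective ?_⟩
  rw [map_smul, coeffEquiv_apply, coeffEquiv_apply, h]

/-- Each conic has exactly q − 1 coefficient vectors, the nonzero multiples of that of its
representative. -/
theorem card_conics_mul [Finite F] (p : (Fin 6 → F) → Prop) (h0 : ¬p 0)
    (hp : ∀ (c : F) a, c ≠ 0 → p a → p (c • a)) :
    Nat.card {C : Conic F // p (coeffVec C.rep)} * (Nat.card F - 1) = Nat.card {a // p a} := by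
  rw [← Nat.card_units, ← Nat.card_prod]
  refine (card_subtype_of_param
    (fun x : {C : Conic F // p (coeffVec C.rep)} × Fˣ => (x.2 : F) • coeffVec x.1.1.rep)
    ?_ fun a => ?_).symm
  · rintro ⟨⟨C, hC⟩, s⟩ ⟨⟨D, hD⟩, t⟩ h
    simp only at h
    have hCD : C = D := eq_of_coeffVec_rep_eq_smul (c := (s : F)⁻¹ * t) (by
      rw [mul_smul, ← h, inv_smul_smul₀ s.ne_zero])
    subst hCD
    have hst := smul_left_injective F (coeffVec_rep_ne_zero C) h
    rw [Units.ext hst]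
  · constructor
    · intro ha
      have ha0 : a ≠ 0 := by
        rintro rfl
        exact h0 ha
      obtain ⟨C, c, hc, h⟩ := exists_conic a ha0
      refine ⟨(⟨C, by rw [h]; exact hp c a hc ha⟩, (Units.mk0 c hc)⁻¹), ?_⟩
      simp [h, smul_smul, hc]
    · rintro ⟨⟨⟨C, hC⟩, s⟩, rfl⟩
      exact hp _ _ s.ne_zero hC

theorem submodule_le_conicHyperplane_iff (P : PG5 F) (C : Conic F) :
    P.submodule ≤ conicHyperplane C ↔ coeffVec C.rep ⬝ᵥ P.rep = 0 := by
  rw [conicHyperplane_eq, Projectivization.submodule_eq, Submodule.span_singleton_le_iff_mem,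
    mem_hyperplaneOf]

theorem setOf_mem_image_conicHyperplane (X : Set (Conic F)) (P : PG5 F) :
    {H | H ∈ conicHyperplane '' X ∧ P.submodule ≤ H} =
      conicHyperplane '' {C | C ∈ X ∧ P.submodule ≤ conicHyperplane C} := by
  ext H
  constructor
  · rintro ⟨⟨C, hC, rfl⟩, h⟩
    exact ⟨C, ⟨hC, h⟩, rfl⟩
  · rintro ⟨C, ⟨hC, h⟩, rfl⟩
    exact ⟨⟨C, hC, rfl⟩, h⟩

theorem ncard_image_conicHyperplane (X : Set (Conic F)) (P : PG5 F) :
    {H | H ∈ conicHyperplane '' X ∧ P.submodule ≤ H}.ncard =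
      {C | C ∈ X ∧ P.submodule ≤ conicHyperplane C}.ncard := by
  rw [setOf_mem_image_conicHyperplane, Set.ncard_image_of_injective _ conicHyperplane_injective]

theorem ncard_typeConics_mul [Finite F] (h2 : (2 : F) ≠ 0) (ε : F) (t : Fin 4) (P : PG5 F) :
    {C | C ∈ typeConics ε t ∧ P.submodule ≤ conicHyperplane C}.ncard * (Nat.card F - 1) =
      typeCard ε t P.rep := by
  rw [typeCard, ← card_conics_mul]
  · rw [← Nat.card_coe_set_eq]
    congr 1
    refine Nat.card_congr (Equiv.subtypeEquivRight fun C => ?_)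
    rw [Set.mem_ofPred_eq, submodule_le_conicHyperplane_iff]
    rfl
  · exact fun h => h.1.ne_zero h2 dualMat_zero
  · rintro c a hc ⟨ha, hy⟩
    rw [dualMat_smul, smul_dotProduct, hy, smul_zero]
    exact ⟨ha.smul hc, rfl⟩

section

variable {L : Type*} [Field L] [Algebra F L]

theorem setOf_conics_eq [Finite F] (h2 : (2 : F) ≠ 0) (hL : Module.finrank F L = 2) {ε : F}
    (hε : ¬IsSquare ε) : {C : Conic F | IsDoubleLine C} = typeConics ε 0 ∧
      {C : Conic F | IsRealLinePair C} = typeConics ε 1 ∧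
      {C : Conic F | IsImagLinePair L C} = typeConics ε 2 ∧
      {C : Conic F | IsNonsingular C} = typeConics ε 3 :=
  ⟨Set.ext fun C => isDoubleLine_iff h2 ε C, Set.ext fun C => isRealLinePair_iff h2 ε C,
    Set.ext fun C => isImagLinePair_iff h2 hL hε C, Set.ext fun C => isNonsingular_iff h2 ε C⟩

theorem hyps_eq_typeHyperplanes [Finite F] (h2 : (2 : F) ≠ 0) (hL : Module.finrank F L = 2)
    {ε : F} (hε : ¬IsSquare ε) : hyps1 F = typeHyperplanes ε 0 ∧
      hyps2r F = typeHyperplanes ε 1 ∧ hyps2i F L = typeHyperplanes ε 2 ∧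
      hyps3 F = typeHyperplanes ε 3 := by
  obtain ⟨e0, e1, e2, e3⟩ := setOf_conics_eq h2 hL hε
  rw [hyps1, hyps2r, hyps2i, hyps3, e0, e1, e2, e3]
  exact ⟨image_typeConics h2 ε 0, image_typeConics h2 ε 1, image_typeConics h2 ε 2,
    image_typeConics h2 ε 3⟩

theorem hyperplaneDistribution_eq [Finite F] (h2 : (2 : F) ≠ 0) (hL : Module.finrank F L = 2)
    {ε : F} (hε : ¬IsSquare ε) {s : Fin 4} {P : PG5 F} (hP : P ∈ typePoints ε s) :
    (fun i => (hyperplaneDistribution L P i : ℚ)) = distValue (Nat.card F) s := by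
  have hq : 1 < Nat.card F := Finite.one_lt_card
  have hq0 : (Nat.card F : ℚ) - 1 ≠ 0 := by
    have : (1 : ℚ) < Nat.card F := by exact_mod_cast hq
    linarith
  have key : ∀ t, ({H | H ∈ typeHyperplanes ε t ∧ P.submodule ≤ H}.ncard : ℚ) =
      distValue (Nat.card F) s t := by
    intro t
    have h := ncard_typeConics_mul h2 ε t P
    rw [← ncard_image_conicHyperplane, image_typeConics h2] at h
    have h' := congrArg (Nat.cast : ℕ → ℚ) h
    rw [typeCard_eq h2 hε hP, Nat.cast_mul, Nat.cast_sub hq.le, Nat.cast_one, mul_comm] at h'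
    exact mul_left_cancel₀ hq0 h'
  obtain ⟨e0, e1, e2, e3⟩ := hyps_eq_typeHyperplanes h2 hL hε
  funext t
  rw [← key t, hyperplaneDistribution, e0, e1, e2, e3]
  fin_cases t <;> rfl

/-! ### Squabs -/

theorem conic_le_iff (C : Conic F) (S : Submodule F (QForms F)) :
    C.submodule ≤ S ↔ coeffVec C.rep ∈ S.map (coeffEquiv (F := F)).toLinearMap := by
  rw [Projectivization.submodule_eq, Submodule.span_singleton_le_iff_mem]
  constructor
  · exact fun h => ⟨_, h, rfl⟩
  · rintro ⟨f, hf, h⟩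
    rwa [← coeffEquiv.injective h]

/-- In coefficient space a squab is a hyperplane; its normal vector, unique up to a scalar, is the
point. -/
theorem existsUnique_isPointOf {S : Submodule F (QForms F)} (hS : IsSquab S) :
    ∃! P : PG5 F, IsPointOf P S := by
  obtain ⟨y, hy, hH⟩ := exists_eq_hyperplaneOf
    (H := S.map (coeffEquiv (F := F)).toLinearMap)
    ((LinearEquiv.finrank_map_eq coeffEquiv S).trans hS)
  refine ⟨Projectivization.mk F y hy, ?_, ?_⟩
  · intro C
    rw [conic_le_iff, hH, mem_hyperplaneOf, conicHyperplane_eq, Projectivization.submodule_mk,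
      Submodule.span_singleton_le_iff_mem, mem_hyperplaneOf, dotProduct_comm]
  · intro P hP
    -- Every nonzero vector orthogonal to `y` is, up to a scalar, the coefficient vector of a conic
    -- of the squab, so it is orthogonal to P as well.
    have hle : hyperplaneOf y ≤ hyperplaneOf P.rep := by
      intro z hz
      by_cases hz0 : z = 0
      · rw [hz0]
        exact zero_mem _
      · obtain ⟨C, c, hc, h⟩ := exists_conic z hz0
        have h1 := hP C
        rw [conic_le_iff, hH, submodule_le_conicHyperplane_iff, h, smul_dotProduct,
          smul_eq_zero_iff_right hc] at h1
        rw [mem_hyperplaneOf, dotProduct_comm]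
        exact h1.1 (Submodule.smul_mem _ _ hz)
    obtain ⟨c, hc, h⟩ := exists_smul_of_hyperplaneOf_le P.rep_nonzero hle
    rw [← P.mk_rep, Projectivization.mk_eq_mk_iff']
    exact ⟨c, h.symm⟩

theorem conicDistribution_eq {S : Submodule F (QForms F)} {P : PG5 F} (h : IsPointOf P S) :
    conicDistribution L S = hyperplaneDistribution L P := by
  have key : ∀ X : Set (Conic F), {C | C ∈ X ∧ C.submodule ≤ S}.ncard =
      {H | H ∈ conicHyperplane '' X ∧ P.submodule ≤ H}.ncard := by
    intro X
    rw [ncard_image_conicHyperplane]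
    congr 1
    ext C
    exact and_congr_right fun _ => h C
  funext t
  fin_cases t
  · exact key {C | IsDoubleLine C}
  · exact key {C | IsRealLinePair C}
  · exact key {C | IsImagLinePair L C}
  · exact key {C | IsNonsingular C}

end

theorem ringChar_ne_two_of_odd_card [Finite F] (h : Odd (Nat.card F)) : ringChar F ≠ 2 := by
  have := Fintype.ofFinite F
  intro h'
  rw [FiniteField.even_card_iff_char_two, ← Nat.card_eq_fintype_card] at h'
  rw [Nat.odd_iff] at h
  omega

end VeroneseConics

theorem mainTheorem1 (q : ℕ) (hq : Odd q) (F : Type*) [Field F] [Finite F] (hF : Nat.card F = q)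
    (L : Type*) [Field L] [Algebra F L] (hL : Module.finrank F L = 2) :
    (pointOrbits F = {pts1 F, pts2e F, pts2i F, pts3 F} ∧ (pointOrbits F).ncard = 4) ∧
    (hyperplaneOrbits F = {hyps1 F, hyps2r F, hyps2i F L, hyps3 F} ∧
      (hyperplaneOrbits F).ncard = 4) ∧
    (∀ P ∈ pts1 F, (fun i => (hyperplaneDistribution L P i : ℚ)) =
      ![(q : ℚ) + 1, (q : ℚ) ^ 3 + (3 * (q : ℚ) ^ 2 + q) / 2, ((q : ℚ) ^ 2 - q) / 2,
        (q : ℚ) ^ 4 - (q : ℚ) ^ 2]) ∧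
    (∀ P ∈ pts2e F, (fun i => (hyperplaneDistribution L P i : ℚ)) =
      ![2 * (q : ℚ) + 1, ((q : ℚ) ^ 3 + 3 * (q : ℚ) ^ 2) / 2,
        ((q : ℚ) ^ 3 + (q : ℚ) ^ 2) / 2 - q, (q : ℚ) ^ 4 - (q : ℚ) ^ 2]) ∧
    (∀ P ∈ pts2i F, (fun i => (hyperplaneDistribution L P i : ℚ)) =
      ![1, ((q : ℚ) ^ 3 + 3 * (q : ℚ) ^ 2) / 2 + q, ((q : ℚ) ^ 3 + (q : ℚ) ^ 2) / 2,
        (q : ℚ) ^ 4 - (q : ℚ) ^ 2]) ∧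
    (∀ P ∈ pts3 F, (fun i => (hyperplaneDistribution L P i : ℚ)) =
      ![(q : ℚ) + 1, ((q : ℚ) ^ 3 + 2 * (q : ℚ) ^ 2 + q) / 2, ((q : ℚ) ^ 3 - q) / 2,
        (q : ℚ) ^ 4]) ∧
    (∀ S : Submodule F (QForms F), IsSquab S → ∃! P : PG5 F, IsPointOf P S) ∧
    (∀ S : Submodule F (QForms F), IsSquab S → ∀ P : PG5 F, IsPointOf P S →
      conicDistribution L S = hyperplaneDistribution L P) := by
  subst hF
  have hch := ringChar_ne_two_of_odd_card hq
  have h2 : (2 : F) ≠ 0 := Ring.two_ne_zero hch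
  -- Any nonsquare will do: it only fixes the representative of the anisotropic class of rank two.
  obtain ⟨ε, hε⟩ := FiniteField.exists_nonsquare hch
  obtain ⟨p0, p1, p2, p3⟩ := pts_eq_typePoints h2 hε
  obtain ⟨e0, e1, e2, e3⟩ := hyps_eq_typeHyperplanes h2 hL hε
  rw [p0, p1, p2, p3, e0, e1, e2, e3]
  exact ⟨pointOrbits_eq h2 hε, hyperplaneOrbits_eq h2 hε,
    fun P hP => hyperplaneDistribution_eq h2 hL hε hP,
    fun P hP => hyperplaneDistribution_eq h2 hL hε hP,
    fun P hP => hyperplaneDistribution_eq h2 hL hε hP,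
    fun P hP => hyperplaneDistribution_eq h2 hL hε hP,
    fun S hS => existsUnique_isPointOf hS, fun S _ P hP => conicDistribution_eq hP⟩
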